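/- Let $u_0:[0,1]\to\mathbb R$ and $j:(0,\infty)\to\mathbb R$, and let $u$ be a classical solution of $$u_t=u_{xx}\ (0<x<1,\ t>0),\qquad u(x,0)=u_0(x)\ (0\le x\le 1),\qquad u(0,t)=0,\quad u_x(1,t)-u(1,t)=j(t)\ (t>0);$$ that is, $u$ is continuous on $[0,1]\times[0,\infty)$, $u_t,u_{xx}$ exist and are continuous on $(0,1)\times(0,\infty)$, and $u_x$ exists and is continuous on $(0,1]\times(0,\infty)$ (one-sided derivative at $x=1$). No compatibility between $u_0$ and $j$ at the corner $(1,0)$ is assumed. Put $$\hat u_0(\lambda)=\int_0^1 e^{\lambda y}u_0(y)\,dy,\qquad \hat u(\lambda,T)=\int_0^1 e^{\lambda y}u(y,T)\,dy,\qquad \hat j(\lambda,t)=\int_0^t e^{\lambda\tau}j(\tau)\,d\tau,$$ $$h(\lambda)=e^{-i\lambda}(1+i\lambda),\qquad \Delta(\lambda)=h(\lambda)-h(-\lambda)=e^{-i\lambda}(1+i\lambda)-e^{i\lambda}(1-i\lambda),$$ $$\mu_0(\lambda)=(i\lambda+1)e^{-i\lambda}\hat u_0(i\lambda)+(i\lambda-1)e^{i\lambda}\hat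 u_0(-i\lambda)+2i\lambda\,\hat j(\lambda^2,t),\qquad \mu_1(\lambda)=\mu_0(\lambda)-\Delta(\lambda)\hat u_0(-i\lambda),$$ and, for $\varepsilon>0$, $$D_+=\{\lambda+i\varepsilon:\tfrac{\pi}{4}\le\arg\lambda\le\tfrac{3\pi}{4}\},\qquad D_-=\{\lambda-i\varepsilon:\tfrac{5\pi}{4}\le\arg\lambda\le\tfrac{7\pi}{4}\},$$ with boundaries $\partial D_\pm$ positively oriented (the domain lies on the left). Let $0<x<1$ and $t>0$, let $j$ be integrable on $(0,t)$, and let $\varepsilon>0$ be so small that $2\varepsilon t<\min(x,1-x)$. Then $\Delta$ has no zeros off the real axis, the following three integrals converge absolutely, and $$u(x,t)=\frac1{2\pi}\left\{\int_{-\infty}^{\infty}e^{i\lambda x-\lambda^2t}\,\hat u_0(-i\lambda)\,d\lambda-\int_{\partial D_+}\frac{e^{i\lambda x-\lambda^2t}}{\Delta(\lambda)}\,\mu_0(\lambda)\,d\lambda-\int_{\partial D_-}\frac{e^{i\lambda x-\lambda^2t}}{\Delta(\lambda)}\,\mu_1(\lambda)\,d\lambda\right\}.$$ Moreover the data on a future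 time slice do not contribute: for every $T\ge t$, with $$\nu_0^+(\lambda)=-\bigl(h(\lambda)\hat u(i\lambda,T)-h(-\lambda)\hat u(-i\lambda,T)\bigr)e^{\lambda^2T},\qquad \nu_1^+(\lambda)=-\bigl(\hat u(i\lambda,T)-\hat u(-i\lambda,T)\bigr)e^{\lambda^2T},$$ the integrals $$\int_{\partial D_+}\frac{e^{i\lambda x-\lambda^2t}}{\Delta(\lambda)}\,\nu_0^+(\lambda)\,d\lambda,\qquad \int_{\partial D_-}\frac{e^{i\lambda x-\lambda^2t}}{\Delta(\lambda)}\,h(\lambda)\,\nu_1^+(\lambda)\,d\lambda$$ converge absolutely and vanish. -/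

import Mathlib

open MeasureTheory Set

namespace RobinHeat

noncomputable section

/-- `u` (with arguments `x`, `t`) is a classical solution of
`u_t = u_xx` for `0 < x < 1`, `t > 0`, with `u(x,0) = u₀(x)` for `0 ≤ x ≤ 1`, and
`u(0,t) = 0`, `u_x(1,t) - u(1,t) = j(t)` for `t > 0`.
It is continuous up to the boundary (including `t = 0`), `u_t` and hence `u_xx` are continuous in
the interior, and `u_x` is continuous up to the side `x = 1`, `t > 0`, where it is the one-sided
derivative. No compatibility of `j` with `u₀` at the corner `x = 1`, `t = 0` is required. -/
structure IsClassicalSolution (u₀ j : ℝ → ℝ) (u : ℝ → ℝ → ℝ) : Prop where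
  continuousOn : ContinuousOn (fun p : ℝ × ℝ => u p.1 p.2) (Icc 0 1 ×ˢ Ici 0)
  differentiable_t : ∀ x ∈ Ioo (0 : ℝ) 1, ∀ t > 0, DifferentiableAt ℝ (fun s => u x s) t
  continuousOn_t :
    ContinuousOn (fun p : ℝ × ℝ => deriv (fun s => u p.1 s) p.2) (Ioo 0 1 ×ˢ Ioi 0)
  differentiable_x : ∀ x ∈ Ioc (0 : ℝ) 1, ∀ t > 0,
    DifferentiableWithinAt ℝ (fun y => u y t) (Icc 0 1) x
  continuousOn_x :
    ContinuousOn (fun p : ℝ × ℝ => derivWithin (fun y => u y p.2) (Icc 0 1) p.1)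
      (Ioc 0 1 ×ˢ Ioi 0)
  heat : ∀ x ∈ Ioo (0 : ℝ) 1, ∀ t > 0,
    HasDerivAt (fun y => deriv (fun y' => u y' t) y) (deriv (fun s => u x s) t) x
  initial : ∀ x ∈ Icc (0 : ℝ) 1, u x 0 = u₀ x
  dirichlet : ∀ t > 0, u 0 t = 0
  robin : ∀ t > 0, derivWithin (fun y => u y t) (Icc 0 1) 1 - u 1 t = j t

/-- `f̂(k) = ∫₀¹ e^{k x} f(x) dx`. -/
def spaceTransform (f : ℝ → ℝ) (k : ℂ) : ℂ :=
  ∫ x in (0 : ℝ)..1, Complex.exp (k * x) * (f x : ℂ)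

/-- `ĵ(k, T) = ∫₀ᵀ e^{k τ} j(τ) dτ`. -/
def timeTransform (j : ℝ → ℝ) (k : ℂ) (T : ℝ) : ℂ :=
  ∫ τ in (0 : ℝ)..T, Complex.exp (k * τ) * (j τ : ℂ)

/-- `h(k) = e^{-ik} (1 + ik)`. -/
def h (k : ℂ) : ℂ := Complex.exp (-Complex.I * k) * (1 + Complex.I * k)

/-- `Δ(k) = e^{-ik} (1 + ik) - e^{ik} (1 - ik)`. -/
def Δ (k : ℂ) : ℂ :=
  Complex.exp (-Complex.I * k) * (1 + Complex.I * k)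
    - Complex.exp (Complex.I * k) * (1 - Complex.I * k)

/-- `μ₀(k) = (ik + 1) e^{-ik} û₀(ik) + (ik - 1) e^{ik} û₀(-ik) + 2ik ĵ(k², t)`. -/
def μ₀ (u₀ j : ℝ → ℝ) (t : ℝ) (k : ℂ) : ℂ :=
  (Complex.I * k + 1) * Complex.exp (-Complex.I * k) * spaceTransform u₀ (Complex.I * k)
    + (Complex.I * k - 1) * Complex.exp (Complex.I * k) * spaceTransform u₀ (-Complex.I * k)
    + 2 * Complex.I * k * timeTransform j (k ^ 2) t

/-- `μ₁(k) = μ₀(k) - Δ(k) û₀(-ik)`. -/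
def μ₁ (u₀ j : ℝ → ℝ) (t : ℝ) (k : ℂ) : ℂ :=
  μ₀ u₀ j t k - Δ k * spaceTransform u₀ (-Complex.I * k)

/-- Contribution of the time slice `T` to `Δ(k) ∫₀ᵀ e^{k² s} u_x(0,s) ds`. -/
def ν₀Future (u : ℝ → ℝ → ℝ) (T : ℝ) (k : ℂ) : ℂ :=
  -(h k * spaceTransform (fun x => u x T) (Complex.I * k)
    - h (-k) * spaceTransform (fun x => u x T) (-Complex.I * k)) * Complex.exp (k ^ 2 * T)

/-- Contribution of the time slice `T` to `Δ(k) ∫₀ᵀ e^{k² s} u_x(1,s) ds`. -/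
def ν₁Future (u : ℝ → ℝ → ℝ) (T : ℝ) (k : ℂ) : ℂ :=
  -(spaceTransform (fun x => u x T) (Complex.I * k)
    - spaceTransform (fun x => u x T) (-Complex.I * k)) * Complex.exp (k ^ 2 * T)

/-- The elementary solution `e^{ikx - k²t}` of the heat equation. -/
def elem (x t : ℝ) (k : ℂ) : ℂ := Complex.exp (Complex.I * k * x - k ^ 2 * t)

/-- The integrand, with respect to `r > 0`, of the integral of `f` over the ray
`{p + r e^{iθ}}`, oriented away from its vertex `p`. -/
def rayIntegrand (p : ℂ) (θ : ℝ) (f : ℂ → ℂ) (r : ℝ) : ℂ :=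
  f (p + r * Complex.exp (Complex.I * θ)) * Complex.exp (Complex.I * θ)

/-- Absolute convergence of the integral of `f` over a ray. -/
def RayIntegrable (p : ℂ) (θ : ℝ) (f : ℂ → ℂ) : Prop :=
  IntegrableOn (rayIntegrand p θ f) (Ioi 0)

/-- The integral of `f` over a ray. -/
def rayIntegral (p : ℂ) (θ : ℝ) (f : ℂ → ℂ) : ℂ :=
  ∫ r in Ioi (0 : ℝ), rayIntegrand p θ f r

/-- Absolute convergence of the integral of `f` over `∂D₊`,
`D₊ = {iε + k : π/4 ≤ arg k ≤ 3π/4}`. -/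
def IntegrableBoundaryPlus (ε : ℝ) (f : ℂ → ℂ) : Prop :=
  RayIntegrable (Complex.I * ε) (Real.pi / 4) f ∧ RayIntegrable (Complex.I * ε) (3 * Real.pi / 4) f

/-- The integral over the positively oriented `∂D₊`, `D₊ = {iε + k : π/4 ≤ arg k ≤ 3π/4}`:
in along the ray of angle `3π/4`, out along the ray of angle `π/4`. -/
def integralBoundaryPlus (ε : ℝ) (f : ℂ → ℂ) : ℂ :=
  rayIntegral (Complex.I * ε) (Real.pi / 4) f - rayIntegral (Complex.I * ε) (3 * Real.pi / 4) f

/-- Absolute convergence of the integral of `f` over `∂D₋`,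
`D₋ = {-iε + k : 5π/4 ≤ arg k ≤ 7π/4}`. -/
def IntegrableBoundaryMinus (ε : ℝ) (f : ℂ → ℂ) : Prop :=
  RayIntegrable (-Complex.I * ε) (5 * Real.pi / 4) f ∧
    RayIntegrable (-Complex.I * ε) (7 * Real.pi / 4) f

/-- The integral over the positively oriented `∂D₋`, `D₋ = {-iε + k : 5π/4 ≤ arg k ≤ 7π/4}`:
in along the ray of angle `7π/4`, out along the ray of angle `5π/4`. -/
def integralBoundaryMinus (ε : ℝ) (f : ℂ → ℂ) : ℂ :=
  rayIntegral (-Complex.I * ε) (5 * Real.pi / 4) f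
    - rayIntegral (-Complex.I * ε) (7 * Real.pi / 4) f

end

end RobinHeat

open MeasureTheory Set
open Filter Topology
open Complex (I)

namespace RobinHeat

/-! Write `L` for `leftFlux` and `R` for `rightFlux`, the time transforms of the boundary values at
the two ends. Pairing the heat equation with `e^{-iky}` gives `e^{k²t} û(-ik,t) = û₀(-ik) - L(k) +
e^{-ik} R(-k)`, and Fourier inversion expresses `u(x,t)` through three integrals over the real line.
In the last one `k ↦ -k` turns `e^{ikx} e^{-ik}` into `e^{ik(1-x)}`, so both flux integrals concern
entire functions times a factor decaying in the upper half-plane.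

The fluxes contain the unknown `u(1,·)`. Pairing the equation instead with `sin(ky)`, which vanishes
at the end where the flux is unknown, gives a relation (`global_relation`) in which the transform of
`u(1,·)` has coefficient `Δ`. Hence `Δ L = μ₀ + ν₀`, and similarly for `R` (`Δ_mul_leftFlux`,
`Δ_mul_rightFlux'`), where the `ν` terms involve only the time slice `t`. Since `Δ` has real zeros
(already `Δ 0 = 0`), the real line is moved to `∂D₊` before dividing. There `Δ` is at least a
multiple of `(1 + ‖k‖) e^{Im k}` (`exists_le_norm_Δ`), so the `ν` terms divided by `Δ` decay in `D₊`
and integrate to zero (`future_plus`, `future_minus`).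

Absolute convergence on the real line is secured by an extra factor `e^{-k²s}`, `s > 0`. The
deformation is made for fixed `s` (`tendsto_integral_elem_mul`). On `∂D₊` the bounds are uniform in
`s`, so dominated convergence gives the limit `s → 0`; on the other side Gaussian-regularised
inversion gives `2π u(x,t)`. Raising the vertex to `iε` costs growth at rate `2εt`, which `2εt < min
x (1 - x)` lets the factors `e^{ikx}` and `e^{ik(1-x)}` absorb. -/

theorem exp_I_mul_re (θ : ℝ) : (Complex.exp (I * θ)).re = Real.cos θ := by
  rw [mul_comm, Complex.exp_ofReal_mul_I_re]

theorem exp_I_mul_im (θ : ℝ) : (Complex.exp (I * θ)).im = Real.sin θ := by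
  rw [mul_comm, Complex.exp_ofReal_mul_I_im]

theorem norm_exp_I_mul (θ : ℝ) : ‖Complex.exp (I * θ)‖ = 1 := by
  rw [mul_comm, Complex.norm_exp_ofReal_mul_I]

/-! ### Integrals along rays and Cauchy's theorem in sectors and strips. -/

theorem continuousOn_rayIntegrand {p : ℂ} {θ : ℝ} {f : ℂ → ℂ}
    (hf : ∀ r : ℝ, 0 ≤ r → ContinuousAt f (p + r * Complex.exp (I * θ))) :
    ContinuousOn (rayIntegrand p θ f) (Ici 0) := by
  intro r hr
  have h : ContinuousAt (fun r : ℝ => p + r * Complex.exp (I * θ)) r := by fun_prop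
  exact ((ContinuousAt.comp (f := fun r : ℝ => p + r * Complex.exp (I * θ)) (hf r hr) h).mul
    continuousAt_const).continuousWithinAt

theorem integrableOn_const_mul_exp_neg (C : ℝ) {c : ℝ} (hc : 0 < c) :
    IntegrableOn (fun r : ℝ => C * Real.exp (-c * r)) (Ioi 0) :=
  (exp_neg_integrableOn_Ioi 0 hc).const_mul C

theorem rayIntegrable_of_decay {p : ℂ} {θ C c : ℝ} {f : ℂ → ℂ} (hc : 0 < c)
    (hf : ∀ r : ℝ, 0 ≤ r → ContinuousAt f (p + r * Complex.exp (I * θ)))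
    (hb : ∀ r : ℝ, 0 ≤ r → ‖f (p + r * Complex.exp (I * θ))‖ ≤ C * Real.exp (-c * r)) :
    RayIntegrable p θ f := by
  refine Integrable.mono' (integrableOn_const_mul_exp_neg C hc)
    (((continuousOn_rayIntegrand hf).mono Ioi_subset_Ici_self).aestronglyMeasurable
      measurableSet_Ioi) ?_
  refine (ae_restrict_iff' measurableSet_Ioi).2 (Eventually.of_forall fun r hr => ?_)
  simpa [rayIntegrand, norm_exp_I_mul] using hb r (le_of_lt hr)

/-- The integral along a ray in the logarithmic parameter, over a symmetric interval. -/
theorem tendsto_integral_comp_exp {p : ℂ} {θ C c : ℝ} {f : ℂ → ℂ} (hc : 0 < c)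
    (hf : ∀ r : ℝ, 0 ≤ r → ContinuousAt f (p + r * Complex.exp (I * θ)))
    (hb : ∀ r : ℝ, 0 ≤ r → ‖f (p + r * Complex.exp (I * θ))‖ ≤ C * Real.exp (-c * r)) :
    Tendsto (fun n : ℝ => ∫ x in (-n)..n,
      f (p + Complex.exp (x + θ * I)) * Complex.exp (x + θ * I)) atTop
      (𝓝 (rayIntegral p θ f)) := by
  have hint := rayIntegrable_of_decay hc hf hb
  have hcont := continuousOn_rayIntegrand hf
  have h1 : ∀ n : ℝ, ∫ x in (-n)..n,
      f (p + Complex.exp (x + θ * I)) * Complex.exp (x + θ * I)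
      = ∫ r in (Real.exp (-n))..(Real.exp n), rayIntegrand p θ f r := by
    intro n
    have := intervalIntegral.integral_deriv_smul_comp'' (a := -n) (b := n) (f := Real.exp)
      (f' := Real.exp) (g := rayIntegrand p θ f)
      Real.continuous_exp.continuousOn (fun x _ => (Real.hasDerivAt_exp x).hasDerivWithinAt)
      Real.continuous_exp.continuousOn
      (hcont.mono (by rintro _ ⟨x, -, rfl⟩; exact (Real.exp_pos x).le))
    rw [← this]
    refine intervalIntegral.integral_congr fun x _ => ?_
    simp only [Function.comp, rayIntegrand, Complex.exp_add, Complex.ofReal_exp,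
      Complex.real_smul, mul_comm (θ : ℂ) I]
    ring
  simp only [h1]
  have hi : ∀ r : ℝ, 0 ≤ r → IntervalIntegrable (rayIntegrand p θ f) volume 0 r := fun r hr =>
    ContinuousOn.intervalIntegrable (hcont.mono (by
      rw [uIcc_of_le hr]; exact Icc_subset_Ici_self))
  have h2 : ∀ n : ℝ, ∫ r in (Real.exp (-n))..(Real.exp n), rayIntegrand p θ f r
      = (∫ r in (0 : ℝ)..(Real.exp n), rayIntegrand p θ f r)
        - ∫ r in (0 : ℝ)..(Real.exp (-n)), rayIntegrand p θ f r := fun n =>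
    (intervalIntegral.integral_interval_sub_left (hi _ (Real.exp_pos _).le)
      (hi _ (Real.exp_pos _).le)).symm
  simp only [h2]
  have h3 := (intervalIntegral_tendsto_integral_Ioi 0 hint tendsto_id).comp Real.tendsto_exp_atTop
  have h4 : Tendsto (fun n : ℝ => ∫ r in (0 : ℝ)..(Real.exp (-n)), rayIntegrand p θ f r) atTop
      (𝓝 0) := by
    have hp := intervalIntegral.continuousOn_primitive_interval' (hi 1 zero_le_one)
      (left_mem_uIcc)
    rw [uIcc_of_le zero_le_one] at hp
    have h0 := hp 0 (by simp)
    rw [ContinuousWithinAt, intervalIntegral.integral_same] at h0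
    refine h0.comp (tendsto_nhdsWithin_iff.2
      ⟨Real.tendsto_exp_atBot.comp tendsto_neg_atTop_atBot, ?_⟩)
    filter_upwards [eventually_ge_atTop 0] with n hn
    exact ⟨(Real.exp_pos _).le, by simpa using hn⟩
  simpa [rayIntegral] using h3.sub h4

/-- In the coordinate `w = log r + iθ` the sector becomes a horizontal strip, and Cauchy's theorem
applies on the rectangles `[-n, n] × [a, b]`. The right side vanishes in the limit by the decay of
`f`, the left one because the Jacobian `e^w` tends to zero at the vertex. -/
theorem rayIntegral_eq_of_decay {p : ℂ} {a b C c : ℝ} {f : ℂ → ℂ} (hab : a ≤ b) (hc : 0 < c)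
    (hf : ∀ θ ∈ Icc a b, ∀ r : ℝ, 0 ≤ r → DifferentiableAt ℂ f (p + r * Complex.exp (I * θ)))
    (hb : ∀ θ ∈ Icc a b, ∀ r : ℝ, 0 ≤ r →
      ‖f (p + r * Complex.exp (I * θ))‖ ≤ C * Real.exp (-c * r)) :
    rayIntegral p a f = rayIntegral p b f := by
  have hC : 0 ≤ C := by
    have := (norm_nonneg _).trans (hb a (left_mem_Icc.2 hab) 0 le_rfl)
    simpa using this
  set g : ℂ → ℂ := fun w => f (p + Complex.exp w) * Complex.exp w with hg
  have hexp : ∀ x θ : ℝ, Complex.exp (x + θ * I)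
      = (Real.exp x : ℝ) * Complex.exp (I * θ) := fun x θ => by
    rw [Complex.exp_add, Complex.ofReal_exp, mul_comm I]
  have hgd : ∀ x : ℝ, ∀ θ ∈ Icc a b, DifferentiableAt ℂ g (x + θ * I) := by
    intro x θ hθ
    have h1 := hf θ hθ (Real.exp x) (Real.exp_pos x).le
    rw [← hexp] at h1
    have h2 : DifferentiableAt ℂ (fun w => p + Complex.exp w) (x + θ * I) := by fun_prop
    exact (DifferentiableAt.comp (f := fun w => p + Complex.exp w) _ h1 h2).mul
      Complex.differentiableAt_exp
  have hgb : ∀ x : ℝ, ∀ θ ∈ Icc a b,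
      ‖g (x + θ * I)‖ ≤ C * (Real.exp x * Real.exp (-c * Real.exp x)) := by
    intro x θ hθ
    have h1 := hb θ hθ (Real.exp x) (Real.exp_pos x).le
    simp only [hg, hexp, norm_mul, norm_exp_I_mul, Complex.norm_real, Real.norm_eq_abs,
      abs_of_pos (Real.exp_pos x), mul_one]
    calc _ ≤ C * Real.exp (-c * Real.exp x) * Real.exp x := by gcongr
      _ = _ := by ring
  have hrect : ∀ n : ℝ, (∫ x in (-n)..n, g (x + a * I)) - (∫ x in (-n)..n, g (x + b * I)) =
      I * (∫ y in a..b, g ((-n : ℝ) + y * I)) - I * (∫ y in a..b, g (n + y * I)) := by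
    intro n
    have := Complex.integral_boundary_rect_eq_zero_of_differentiableOn g
      ((-n : ℝ) + a * I) ((n : ℝ) + b * I) (by
        intro w hw
        rw [Complex.mem_reProdIm] at hw
        have h2 := hw.2
        simp [uIcc_of_le hab] at h2
        have := hgd w.re w.im h2
        rw [Complex.re_add_im] at this
        exact this.differentiableWithinAt)
    simp at this
    simp only [Complex.ofReal_neg]
    linear_combination this
  have hvert : ∀ m : ℝ, ‖∫ y in a..b, g (m + y * I)‖
      ≤ C * (Real.exp m * Real.exp (-c * Real.exp m)) * |b - a| := fun m =>
    intervalIntegral.norm_integral_le_of_norm_le_const fun y hy => by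
      rw [uIoc_of_le hab] at hy
      exact hgb m y ⟨hy.1.le, hy.2⟩
  have hlimr : Tendsto (fun r : ℝ => r * Real.exp (-c * r)) atTop (𝓝 0) := by
    have := Real.tendsto_pow_mul_exp_neg_atTop_nhds_zero 1
    have h2 := (this.comp (tendsto_id.const_mul_atTop hc)).const_mul c⁻¹
    simp only [mul_zero] at h2
    refine h2.congr fun r => ?_
    simp [Function.comp]
    field_simp
  have hlim1 : Tendsto (fun n : ℝ => ∫ y in a..b, g (n + y * I)) atTop (𝓝 0) := by
    refine squeeze_zero_norm hvert ?_
    have := ((hlimr.comp Real.tendsto_exp_atTop).const_mul C).mul_const |b - a|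
    simpa [Function.comp_def] using this
  have hlim2 : Tendsto (fun n : ℝ => ∫ y in a..b, g ((-n : ℝ) + y * I)) atTop (𝓝 0) := by
    have h1 : Tendsto (fun m : ℝ => ∫ y in a..b, g (m + y * I)) atBot (𝓝 0) := by
      refine squeeze_zero_norm hvert ?_
      have h0 : Tendsto (fun r : ℝ => r * Real.exp (-c * r)) (𝓝 0) (𝓝 (0 * Real.exp (-c * 0))) :=
        Continuous.tendsto (by fun_prop) 0
      have := ((h0.comp Real.tendsto_exp_atBot).const_mul C).mul_const |b - a|
      simpa [Function.comp_def] using this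
    exact h1.comp tendsto_neg_atTop_atBot
  have hA := tendsto_integral_comp_exp hc
    (fun r hr => (hf a (left_mem_Icc.2 hab) r hr).continuousAt) (hb a (left_mem_Icc.2 hab))
  have hB := tendsto_integral_comp_exp hc
    (fun r hr => (hf b (right_mem_Icc.2 hab) r hr).continuousAt) (hb b (right_mem_Icc.2 hab))
  have h0 := (hlim2.const_mul I).sub (hlim1.const_mul I)
  simp only [mul_zero, sub_zero] at h0
  exact sub_eq_zero.1 (tendsto_nhds_unique (hA.sub hB) (h0.congr fun n => (hrect n).symm))

theorem integrable_of_gaussian_bound {f : ℝ → ℂ} {B s : ℝ} (hs : 0 < s) (hf : Continuous f)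
    (hb : ∀ x, ‖f x‖ ≤ B * Real.exp (-s * x ^ 2)) : Integrable f :=
  ((integrable_exp_neg_mul_sq hs).const_mul B).mono' hf.aestronglyMeasurable
    (Eventually.of_forall hb)

/-- Cauchy's theorem on `[-n, n] × [0, ε]`; the Gaussian bound kills the vertical sides. This raises
the real line to the height of the vertex of `D₊`. -/
theorem integral_eq_integral_add_mul_I {f : ℂ → ℂ} {ε B s : ℝ} (hε : 0 ≤ ε) (hs : 0 < s)
    (hf : Differentiable ℂ f)
    (hb : ∀ x y : ℝ, 0 ≤ y → y ≤ ε → ‖f (x + y * I)‖ ≤ B * Real.exp (-s * x ^ 2)) :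
    ∫ x : ℝ, f x = ∫ x : ℝ, f (x + ε * I) := by
  have hline : ∀ y : ℝ, 0 ≤ y → y ≤ ε → Integrable (fun x : ℝ => f (x + y * I)) := fun y h1 h2 =>
    integrable_of_gaussian_bound hs (hf.continuous.comp (by fun_prop)) fun x => hb x y h1 h2
  have hlim : ∀ y : ℝ, 0 ≤ y → y ≤ ε → Tendsto (fun n : ℝ => ∫ x in (-n)..n, f (x + y * I)) atTop
      (𝓝 (∫ x : ℝ, f (x + y * I))) := fun y h1 h2 =>
    intervalIntegral_tendsto_integral (hline y h1 h2) tendsto_neg_atTop_atBot tendsto_id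
  have hvert : ∀ m : ℝ, ‖∫ y in (0 : ℝ)..ε, f (m + y * I)‖
      ≤ B * Real.exp (-s * m ^ 2) * |ε - 0| := fun m =>
    intervalIntegral.norm_integral_le_of_norm_le_const fun y hy => by
      rw [uIoc_of_le hε] at hy
      exact hb m y hy.1.le hy.2
  have hg : Tendsto (fun n : ℝ => B * Real.exp (-s * n ^ 2) * |ε - 0|) atTop (𝓝 0) := by
    have h1 : Tendsto (fun n : ℝ => -s * n ^ 2) atTop atBot :=
      (tendsto_pow_atTop two_ne_zero).const_mul_atTop_of_neg (by linarith)
    have := ((Real.tendsto_exp_atBot.comp h1).const_mul B).mul_const |ε - 0|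
    simpa using this
  have hv1 : Tendsto (fun n : ℝ => ∫ y in (0 : ℝ)..ε, f (n + y * I)) atTop (𝓝 0) :=
    squeeze_zero_norm hvert hg
  have hv2 : Tendsto (fun n : ℝ => ∫ y in (0 : ℝ)..ε, f ((-n : ℝ) + y * I)) atTop (𝓝 0) :=
    squeeze_zero_norm (fun n => hvert (-n)) (by simpa using hg)
  have hrect : ∀ n : ℝ, (∫ x in (-n)..n, f (x + (0 : ℝ) * I)) - (∫ x in (-n)..n, f (x + ε * I)) =
      I * (∫ y in (0 : ℝ)..ε, f ((-n : ℝ) + y * I)) - I * (∫ y in (0 : ℝ)..ε, f (n + y * I)) := by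
    intro n
    have := Complex.integral_boundary_rect_eq_zero_of_differentiableOn f
      ((-n : ℝ) + (0 : ℝ) * I) ((n : ℝ) + ε * I) hf.differentiableOn
    simp at this
    simp only [Complex.ofReal_neg, Complex.ofReal_zero, zero_mul, add_zero]
    linear_combination this
  have h0 := (hv2.const_mul I).sub (hv1.const_mul I)
  simp only [mul_zero, sub_zero] at h0
  have := sub_eq_zero.1 (tendsto_nhds_unique ((hlim 0 le_rfl hε).sub (hlim ε hε le_rfl))
    (h0.congr fun n => (hrect n).symm))
  simpa using this

theorem integral_add_mul_I_eq_rayIntegral {f : ℂ → ℂ} {ε : ℝ}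
    (hf : Integrable fun x : ℝ => f (x + ε * I)) :
    ∫ x : ℝ, f (x + ε * I) = rayIntegral (I * ε) 0 f - rayIntegral (I * ε) Real.pi f := by
  rw [← intervalIntegral.integral_Iic_add_Ioi (b := 0) hf.integrableOn hf.integrableOn,
    show Iic (0 : ℝ) = Iic (-0) by simp, ← integral_comp_neg_Ioi (c := 0), rayIntegral, rayIntegral]
  have e : Complex.exp (I * Real.pi) = -1 := by rw [mul_comm, Complex.exp_pi_mul_I]
  simp only [rayIntegrand, e, mul_neg, mul_one, integral_neg, Complex.ofReal_zero, mul_zero,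
    Complex.exp_zero, Complex.ofReal_neg]
  rw [sub_neg_eq_add, add_comm]
  congr 1 <;> refine integral_congr_ae (Eventually.of_forall fun x => ?_) <;> simp only <;>
    congr 1 <;> ring

/-- The reflection `k ↦ -k` carries `∂D₊` to `∂D₋` with its orientation and changes the sign of
`dk`. All estimates can therefore be made in the upper half-plane. -/
theorem rayIntegrand_add_pi (p : ℂ) (θ : ℝ) (f : ℂ → ℂ) :
    rayIntegrand (-p) (θ + Real.pi) f = -rayIntegrand p θ (fun k => f (-k)) := by
  ext r
  have e : Complex.exp (I * (θ + Real.pi : ℝ)) = -Complex.exp (I * θ) := by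
    rw [Complex.ofReal_add, mul_add, Complex.exp_add, mul_comm I (Real.pi : ℂ),
      Complex.exp_pi_mul_I]; ring
  simp only [rayIntegrand, e, Pi.neg_apply]
  rw [show -p + r * -Complex.exp (I * θ) = -(p + r * Complex.exp (I * θ)) by ring]
  ring

theorem integralBoundaryMinus_eq (ε : ℝ) (f : ℂ → ℂ) :
    integralBoundaryMinus ε f = -integralBoundaryPlus ε (fun k => f (-k)) := by
  unfold integralBoundaryMinus integralBoundaryPlus rayIntegral
  rw [show 5 * Real.pi / 4 = Real.pi / 4 + Real.pi by ring,
    show 7 * Real.pi / 4 = 3 * Real.pi / 4 + Real.pi by ring, neg_mul,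
    rayIntegrand_add_pi, rayIntegrand_add_pi]
  simp only [Pi.neg_apply, integral_neg]
  ring

theorem integrableBoundaryMinus_iff (ε : ℝ) (f : ℂ → ℂ) :
    IntegrableBoundaryMinus ε f ↔ IntegrableBoundaryPlus ε (fun k => f (-k)) := by
  unfold IntegrableBoundaryMinus IntegrableBoundaryPlus RayIntegrable
  rw [show 5 * Real.pi / 4 = Real.pi / 4 + Real.pi by ring,
    show 7 * Real.pi / 4 = 3 * Real.pi / 4 + Real.pi by ring, neg_mul,
    rayIntegrand_add_pi, rayIntegrand_add_pi, IntegrableOn,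
    integrable_neg_iff, IntegrableOn, integrable_neg_iff]
  rfl

/-! ### Size of the heat exponential and deformation of the real line to `∂D₊`. -/

theorem sq_re (k : ℂ) : (k ^ 2).re = k.re ^ 2 - k.im ^ 2 := by
  simp [pow_two]

theorem norm_elem (X σ : ℝ) (k : ℂ) :
    ‖elem X σ k‖ = Real.exp (-X * k.im - σ * (k ^ 2).re) := by
  rw [elem, Complex.norm_exp]
  congr 1
  simp
  ring

theorem differentiable_elem (X σ : ℝ) : Differentiable ℂ (elem X σ) := by
  unfold elem; fun_prop

theorem ray_re (ε r θ : ℝ) : (I * ε + r * Complex.exp (I * θ)).re = r * Real.cos θ := by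
  simp [exp_I_mul_re]

theorem ray_im (ε r θ : ℝ) : (I * ε + r * Complex.exp (I * θ)).im = ε + r * Real.sin θ := by
  simp [exp_I_mul_im]

/-- Used with `a = r sin θ` or `a = r cos θ`, whichever is larger in modulus; `1/2` is a convenient
weakening of `1/√2`. -/
theorem half_le_of_sq_add_sq {r a : ℝ} (hr : 0 ≤ r) (h : r ^ 2 ≤ 2 * a ^ 2) : r / 2 ≤ |a| := by
  rw [← abs_of_nonneg (by positivity : 0 ≤ r / 2)]
  exact sq_le_sq.1 (by nlinarith [sq_nonneg r])

/-- The quantity is `cos 2θ`, the sign of `Re (k - iε)²` along the ray of angle `θ` from `iε`. -/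
theorem cos_sq_sub_sin_sq_nonneg_of_le {θ : ℝ} (h0 : 0 ≤ θ) (h1 : θ ≤ Real.pi / 4) :
    0 ≤ Real.cos θ ^ 2 - Real.sin θ ^ 2 := by
  rw [← Real.cos_two_mul']
  exact Real.cos_nonneg_of_neg_pi_div_two_le_of_le (by linarith [Real.pi_pos]) (by linarith)

theorem cos_sq_sub_sin_sq_nonneg_of_ge {θ : ℝ} (h0 : 3 * Real.pi / 4 ≤ θ) (h1 : θ ≤ Real.pi) :
    0 ≤ Real.cos θ ^ 2 - Real.sin θ ^ 2 := by
  have := cos_sq_sub_sin_sq_nonneg_of_le (θ := Real.pi - θ) (by linarith) (by linarith)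
  simpa using this

theorem cos_sq_sub_sin_sq_nonpos {θ : ℝ} (h0 : Real.pi / 4 ≤ θ) (h1 : θ ≤ 3 * Real.pi / 4) :
    Real.cos θ ^ 2 - Real.sin θ ^ 2 ≤ 0 := by
  rw [← Real.cos_two_mul']
  exact Real.cos_nonpos_of_pi_div_two_le_of_le (by linarith) (by linarith)

/-- A function holomorphic in the upper half-plane which decays exponentially in `D₊` has
vanishing integral over `∂D₊`. -/
theorem integralBoundaryPlus_eq_zero {f : ℂ → ℂ} {ε C c : ℝ} (hε : 0 < ε) (hC : 0 ≤ C)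
    (hc : 0 < c) (hf : ∀ k : ℂ, 0 < k.im → DifferentiableAt ℂ f k)
    (hb : ∀ k : ℂ, ε ≤ k.im → (k ^ 2).re ≤ 0 → ‖f k‖ ≤ C * Real.exp (-c * k.im)) :
    IntegrableBoundaryPlus ε f ∧ integralBoundaryPlus ε f = 0 := by
  have hπ := Real.pi_pos
  have hsin : ∀ θ ∈ Icc (Real.pi / 4) (3 * Real.pi / 4), 0 ≤ Real.sin θ := fun θ hθ =>
    Real.sin_nonneg_of_nonneg_of_le_pi (by linarith [hθ.1]) (by linarith [hθ.2])
  have hd : ∀ θ ∈ Icc (Real.pi / 4) (3 * Real.pi / 4), ∀ r : ℝ, 0 ≤ r →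
      DifferentiableAt ℂ f (I * ε + r * Complex.exp (I * θ)) := fun θ hθ r hr =>
    hf _ (by rw [ray_im]; have := mul_nonneg hr (hsin θ hθ); linarith)
  have hbd : ∀ θ ∈ Icc (Real.pi / 4) (3 * Real.pi / 4), ∀ r : ℝ, 0 ≤ r →
      ‖f (I * ε + r * Complex.exp (I * θ))‖ ≤ C * Real.exp (-(c / 2) * r) := by
    intro θ hθ r hr
    have h0 := mul_nonneg hr (hsin θ hθ)
    have h1 := cos_sq_sub_sin_sq_nonpos hθ.1 hθ.2
    have h3 : (r * Real.cos θ) ^ 2 ≤ (r * Real.sin θ) ^ 2 := by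
      nlinarith [mul_nonneg (sq_nonneg r) (neg_nonneg.2 h1)]
    -- In `D₊` the sine dominates the cosine, so `r / 2 ≤ Im k`; decay in `Im k` becomes decay in
    -- `r` at half the rate.
    have h4 := half_le_of_sq_add_sq (a := r * Real.sin θ) hr (by
      nlinarith [Real.sin_sq_add_cos_sq θ, h3,
        congrArg (fun z => r ^ 2 * z) (Real.sin_sq_add_cos_sq θ)])
    rw [abs_of_nonneg h0] at h4
    refine (hb _ (by rw [ray_im]; linarith) (by rw [sq_re, ray_re, ray_im]; nlinarith)).trans ?_
    refine mul_le_mul_of_nonneg_left (Real.exp_le_exp.2 ?_) hC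
    rw [ray_im]
    nlinarith
  have m1 : Real.pi / 4 ∈ Icc (Real.pi / 4) (3 * Real.pi / 4) := ⟨le_rfl, by linarith⟩
  have m2 : 3 * Real.pi / 4 ∈ Icc (Real.pi / 4) (3 * Real.pi / 4) := ⟨by linarith, le_rfl⟩
  refine ⟨⟨rayIntegrable_of_decay (half_pos hc) (fun r hr => (hd _ m1 r hr).continuousAt)
    (hbd _ m1), rayIntegrable_of_decay (half_pos hc) (fun r hr => (hd _ m2 r hr).continuousAt)
    (hbd _ m2)⟩, ?_⟩
  rw [integralBoundaryPlus, rayIntegral_eq_of_decay (by linarith) (half_pos hc) hd hbd, sub_self]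

/-- The bound outside `D₊`, where the heat exponential is controlled by the distance to the real
axis. -/
theorem norm_elem_mul_le {P : ℂ → ℂ} {X t s s₀ ε C c : ℝ} (hε : 0 < ε) (ht : 0 ≤ t) (hC : 0 ≤ C)
    (hX : 0 ≤ X) (hss : s ≤ s₀) (hc : 2 * ε * (t + s₀) + c ≤ X)
    (hP : ∀ k : ℂ, ε ≤ k.im → ‖P k‖ ≤ C * (1 + Real.exp (t * (k ^ 2).re)))
    {k : ℂ} {a b : ℝ} (hka : k.re = a) (hkb : k.im = ε + b) (hb : 0 ≤ b) (hab : b ^ 2 ≤ a ^ 2) :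
    ‖elem X (t + s) k * P k‖
      ≤ 2 * C * Real.exp ((t + s₀) * ε ^ 2) * Real.exp (-c * b - s * (a ^ 2 - b ^ 2)) := by
  -- With `k = a + i(ε + b)` one has `Re k² = (a² - b²) - 2εb - ε²`. The growth `2εσb` is absorbed
  -- by `Xb`, leaving the rate `c`. Both `σ = t + s` and `σ = s` are needed, one for each summand in
  -- the bound for `P`.
  have hkey : ∀ σ : ℝ, s ≤ σ → σ ≤ t + s₀ → Real.exp (-X * k.im - σ * (k ^ 2).re) ≤
      Real.exp ((t + s₀) * ε ^ 2) * Real.exp (-c * b - s * (a ^ 2 - b ^ 2)) := by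
    intro σ h1 h2
    rw [← Real.exp_add, sq_re, hka, hkb]
    gcongr
    have e1 : s * (a ^ 2 - b ^ 2) ≤ σ * (a ^ 2 - b ^ 2) := by gcongr
    have e2 : σ * ε ^ 2 ≤ (t + s₀) * ε ^ 2 := by gcongr
    have e3 : 2 * ε * σ * b ≤ 2 * ε * (t + s₀) * b := by gcongr
    have e4 : (2 * ε * (t + s₀) + c) * b ≤ X * b := by gcongr
    have e5 : 0 ≤ X * ε := by positivity
    nlinarith
  rw [norm_mul, norm_elem]
  have hPk := hP k (by rw [hkb]; linarith)
  calc _ ≤ Real.exp (-X * k.im - (t + s) * (k ^ 2).re) *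
        (C * (1 + Real.exp (t * (k ^ 2).re))) := by gcongr
    _ = C * (Real.exp (-X * k.im - (t + s) * (k ^ 2).re)
        + Real.exp (-X * k.im - s * (k ^ 2).re)) := by
        rw [show -X * k.im - s * (k ^ 2).re
          = (-X * k.im - (t + s) * (k ^ 2).re) + t * (k ^ 2).re by ring, Real.exp_add]
        ring
    _ ≤ C * (Real.exp ((t + s₀) * ε ^ 2) * Real.exp (-c * b - s * (a ^ 2 - b ^ 2))
        + Real.exp ((t + s₀) * ε ^ 2) * Real.exp (-c * b - s * (a ^ 2 - b ^ 2))) := by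
        gcongr
        · exact hkey _ (by linarith) (by linarith)
        · exact hkey _ le_rfl (by linarith)
    _ = _ := by ring

/-- In the strip `Re k² ≥ a² - ε²`. The growth `e^{t Re k²}` of `P` can cancel the whole heat factor
at time `t`, so only the regularising Gaussian `e^{-s a²}` remains; half of it is spent on the
linear factor, through `|a| ≤ (s/2) a² + 1/(2s)`. -/
theorem norm_elem_mul_le_of_strip {P : ℂ → ℂ} {X t s ε C : ℝ} (hε : 0 ≤ ε) (ht : 0 ≤ t)
    (hC : 0 ≤ C) (hX : 0 ≤ X) (hs : 0 < s)
    (hP : ∀ k : ℂ, 0 ≤ k.im → k.im ≤ ε →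
      ‖P k‖ ≤ C * (1 + ‖k‖) * (1 + Real.exp (t * (k ^ 2).re)))
    (a b : ℝ) (hb : 0 ≤ b) (hbε : b ≤ ε) :
    ‖elem X (t + s) (a + b * I) * P (a + b * I)‖
      ≤ (2 * C * Real.exp ((t + s) * ε ^ 2) * (1 + ε + 1 / (2 * s)))
        * Real.exp (-(s / 2) * a ^ 2) := by
  set k : ℂ := a + b * I with hk
  have hre : k.re = a := by simp [hk]
  have him : k.im = b := by simp [hk]
  have hkn : ‖k‖ ≤ |a| + ε := by
    have := Complex.norm_le_abs_re_add_abs_im k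
    rw [hre, him, abs_of_nonneg hb] at this
    linarith
  have hkey : ∀ σ : ℝ, s ≤ σ → σ ≤ t + s → Real.exp (-X * k.im - σ * (k ^ 2).re) ≤
      Real.exp ((t + s) * ε ^ 2) * Real.exp (-s * a ^ 2) := by
    intro σ h1 h2
    rw [← Real.exp_add, sq_re, hre, him]
    gcongr
    have e1 : s * a ^ 2 ≤ σ * a ^ 2 := by gcongr
    have e2 : σ * b ^ 2 ≤ (t + s) * ε ^ 2 := by gcongr
    have e5 : 0 ≤ X * b := by positivity
    nlinarith
  have hlin : 1 + ‖k‖ ≤ (1 + ε + 1 / (2 * s)) * Real.exp (s / 2 * a ^ 2) := by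
    have h1 : |a| ≤ s / 2 * a ^ 2 + 1 / (2 * s) := by
      have : 0 ≤ (s * |a| - 1) ^ 2 / (2 * s) := by positivity
      have e : (s * |a| - 1) ^ 2 / (2 * s) = s / 2 * a ^ 2 + 1 / (2 * s) - |a| := by
        rw [← sq_abs a]; field_simp; ring
      linarith
    have h2 := Real.add_one_le_exp (s / 2 * a ^ 2)
    have h3 : 0 ≤ 1 / (2 * s) := by positivity
    have h4 : 0 ≤ s / 2 * a ^ 2 := by positivity
    calc 1 + ‖k‖ ≤ (1 + ε + 1 / (2 * s)) * (s / 2 * a ^ 2 + 1) := by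
          nlinarith [mul_nonneg hε h4, mul_nonneg h3 h4]
      _ ≤ _ := by gcongr
  rw [norm_mul, norm_elem]
  have hPk := hP k (by rw [him]; exact hb) (by rw [him]; exact hbε)
  have hD : 0 ≤ 1 + ε + 1 / (2 * s) := by positivity
  calc _ ≤ Real.exp (-X * k.im - (t + s) * (k ^ 2).re) *
        (C * (1 + ‖k‖) * (1 + Real.exp (t * (k ^ 2).re))) := by gcongr
    _ = C * (1 + ‖k‖) * (Real.exp (-X * k.im - (t + s) * (k ^ 2).re)
        + Real.exp (-X * k.im - s * (k ^ 2).re)) := by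
        rw [show -X * k.im - s * (k ^ 2).re
          = (-X * k.im - (t + s) * (k ^ 2).re) + t * (k ^ 2).re by ring, Real.exp_add]
        ring
    _ ≤ C * ((1 + ε + 1 / (2 * s)) * Real.exp (s / 2 * a ^ 2)) *
        (Real.exp ((t + s) * ε ^ 2) * Real.exp (-s * a ^ 2)
        + Real.exp ((t + s) * ε ^ 2) * Real.exp (-s * a ^ 2)) := by
        gcongr
        · exact hkey _ (by linarith) (by linarith)
        · exact hkey _ le_rfl (by linarith)
    _ = _ := by
        rw [show -s * a ^ 2 = -(s / 2) * a ^ 2 - s / 2 * a ^ 2 by ring, Real.exp_sub]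
        field_simp
        ring

/-- Deformation of the real line to `∂D₊`, in the limit of vanishing regularisation. -/
theorem tendsto_integral_elem_mul {P : ℂ → ℂ} {X t ε C : ℝ} (hε : 0 < ε) (ht : 0 ≤ t)
    (hC : 0 ≤ C) (hX : 2 * ε * t < X) (hPd : Differentiable ℂ P)
    (hP : ∀ k : ℂ, ε ≤ k.im → ‖P k‖ ≤ C * (1 + Real.exp (t * (k ^ 2).re)))
    (hP' : ∀ k : ℂ, 0 ≤ k.im → k.im ≤ ε →
      ‖P k‖ ≤ C * (1 + ‖k‖) * (1 + Real.exp (t * (k ^ 2).re))) :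
    (∀ s > 0, Integrable fun k : ℝ => elem X (t + s) k * P k) ∧
    IntegrableBoundaryPlus ε (fun k => elem X t k * P k) ∧
    Tendsto (fun s : ℝ => ∫ k : ℝ, elem X (t + s) k * P k) (𝓝[>] 0)
      (𝓝 (integralBoundaryPlus ε (fun k => elem X t k * P k))) := by
  have hπ := Real.pi_pos
  have hX0 : 0 ≤ X := le_trans (by positivity) hX.le
  -- The slack `X - 2εt` is shared equally between `2εs₀` and the decay rate `c`.
  obtain ⟨s₀, c, hs₀, hc, hcX⟩ : ∃ s₀ c : ℝ, 0 < s₀ ∧ 0 < c ∧ 2 * ε * (t + s₀) + c ≤ X := by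
    refine ⟨(X - 2 * ε * t) / (4 * ε), (X - 2 * ε * t) / 2, by
      have : 0 < X - 2 * ε * t := by linarith
      positivity, by linarith, le_of_eq ?_⟩
    field_simp
    ring
  have hd : ∀ s : ℝ, Differentiable ℂ fun k => elem X (t + s) k * P k := fun s =>
    (differentiable_elem _ _).mul hPd
  set D := 2 * C * Real.exp ((t + s₀) * ε ^ 2) with hD
  have hD0 : 0 ≤ D := by positivity
  -- the rays bounding `D₊`
  have hray : ∀ s, 0 ≤ s → s ≤ s₀ → ∀ θ, 0 ≤ Real.sin θ →
      Real.cos θ ^ 2 = Real.sin θ ^ 2 → ∀ r : ℝ, 0 ≤ r →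
      ‖elem X (t + s) (I * ε + r * Complex.exp (I * θ)) * P (I * ε + r * Complex.exp (I * θ))‖
        ≤ D * Real.exp (-(c / 2) * r) := by
    intro s h1 h2 θ hsin hθ r hr
    have h0 := mul_nonneg hr hsin
    have hsq : (r * Real.sin θ) ^ 2 = (r * Real.cos θ) ^ 2 := by rw [mul_pow, mul_pow, hθ]
    have h4 := half_le_of_sq_add_sq (a := r * Real.sin θ) hr (by
      nlinarith [Real.sin_sq_add_cos_sq θ, hsq,
        congrArg (fun z => r ^ 2 * z) (Real.sin_sq_add_cos_sq θ)])
    rw [abs_of_nonneg h0] at h4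
    refine (norm_elem_mul_le hε ht hC hX0 h2 hcX hP (ray_re _ _ _) (ray_im _ _ _) h0
      hsq.le).trans ?_
    gcongr
    rw [hsq]
    nlinarith
  -- the sectors between the real direction and `D₊`
  have hsector : ∀ s, 0 < s → s ≤ s₀ → ∀ θ, 0 ≤ Real.sin θ →
      0 ≤ Real.cos θ ^ 2 - Real.sin θ ^ 2 → ∀ r : ℝ, 0 ≤ r →
      ‖elem X (t + s) (I * ε + r * Complex.exp (I * θ)) * P (I * ε + r * Complex.exp (I * θ))‖
        ≤ D * Real.exp (c ^ 2 / (4 * s)) * Real.exp (-(c / 2) * r) := by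
    intro s h1 h2 θ hsin hθ r hr
    have h0 := mul_nonneg hr hsin
    have hsq : (r * Real.sin θ) ^ 2 ≤ (r * Real.cos θ) ^ 2 := by
      nlinarith [mul_nonneg (sq_nonneg r) hθ]
    have h4 := half_le_of_sq_add_sq (a := r * Real.cos θ) hr (by
      nlinarith [Real.sin_sq_add_cos_sq θ, hsq,
        congrArg (fun z => r ^ 2 * z) (Real.sin_sq_add_cos_sq θ)])
    refine (norm_elem_mul_le hε ht hC hX0 h2 hcX hP (ray_re _ _ _) (ray_im _ _ _) h0
      hsq).trans ?_
    rw [mul_assoc D, ← Real.exp_add]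
    gcongr
    have hle : r * Real.sin θ ≤ |r * Real.cos θ| := by
      rw [← abs_of_nonneg h0]; exact sq_le_sq.1 hsq
    rw [← sq_abs (r * Real.cos θ)]
    generalize |r * Real.cos θ| = a at *
    generalize r * Real.sin θ = b at *
    -- Away from `∂D₊` the term `-cb` alone is too weak; completing the square trades `s (a - b)²`
    -- for the missing `c (a - b)`. The resulting constant blows up as `s → 0`, which is harmless
    -- because the rotation is made for fixed `s`.
    have e1 : (a - b) ^ 2 ≤ a ^ 2 - b ^ 2 := by nlinarith
    have e2 : s * (a - b) ^ 2 ≤ s * (a ^ 2 - b ^ 2) := by gcongr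
    have e3 : c * (a - b) ≤ s * (a - b) ^ 2 + c ^ 2 / (4 * s) := by
      have : 0 ≤ (2 * s * (a - b) - c) ^ 2 / (4 * s) := by positivity
      have e : (2 * s * (a - b) - c) ^ 2 / (4 * s)
          = s * (a - b) ^ 2 + c ^ 2 / (4 * s) - c * (a - b) := by field_simp; ring
      linarith
    nlinarith
  have hline : ∀ s, 0 < s → Integrable (fun k : ℝ => elem X (t + s) (k + ε * I) * P (k + ε * I)) :=
    fun s hs => integrable_of_gaussian_bound (half_pos hs)
      ((hd s).continuous.comp (f := fun k : ℝ => (k + ε * I : ℂ)) (by fun_prop))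
      fun a => norm_elem_mul_le_of_strip hε.le ht hC hX0 hs hP' a ε hε.le le_rfl
  have hsp : 0 ≤ Real.sin (Real.pi / 4) := Real.sin_nonneg_of_nonneg_of_le_pi (by linarith)
    (by linarith)
  have hsp3 : 0 ≤ Real.sin (3 * Real.pi / 4) := Real.sin_nonneg_of_nonneg_of_le_pi (by linarith)
    (by linarith)
  have hcs : Real.cos (Real.pi / 4) ^ 2 = Real.sin (Real.pi / 4) ^ 2 :=
    le_antisymm (sub_nonpos.1 (cos_sq_sub_sin_sq_nonpos le_rfl (by linarith)))
      (sub_nonneg.1 (cos_sq_sub_sin_sq_nonneg_of_le (by linarith) le_rfl))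
  have hcs3 : Real.cos (3 * Real.pi / 4) ^ 2 = Real.sin (3 * Real.pi / 4) ^ 2 :=
    le_antisymm (sub_nonpos.1 (cos_sq_sub_sin_sq_nonpos (by linarith) le_rfl))
      (sub_nonneg.1 (cos_sq_sub_sin_sq_nonneg_of_ge le_rfl (by linarith)))
  -- Raise the line to height `ε`, cut it at `iε` into rays of angles `0` and `π`, and rotate these
  -- to `π/4` and `3π/4`.
  have hdeform : ∀ s, 0 < s → s ≤ s₀ → ∫ k : ℝ, elem X (t + s) k * P k
      = integralBoundaryPlus ε (fun k => elem X (t + s) k * P k) := by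
    intro s h1 h2
    rw [integral_eq_integral_add_mul_I hε.le (half_pos h1) (hd s)
      (norm_elem_mul_le_of_strip hε.le ht hC hX0 h1 hP'),
      integral_add_mul_I_eq_rayIntegral (f := fun k => elem X (t + s) k * P k) (hline s h1),
      integralBoundaryPlus]
    congr 1
    · refine rayIntegral_eq_of_decay (by linarith) (half_pos hc) (fun θ _ r _ => hd s _)
        fun θ hθ r hr => hsector s h1 h2 θ (Real.sin_nonneg_of_nonneg_of_le_pi hθ.1
          (by linarith [hθ.2])) (cos_sq_sub_sin_sq_nonneg_of_le hθ.1 hθ.2) r hr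
    · refine (rayIntegral_eq_of_decay (by linarith) (half_pos hc) (fun θ _ r _ => hd s _)
        fun θ hθ r hr => hsector s h1 h2 θ (Real.sin_nonneg_of_nonneg_of_le_pi
          (by linarith [hθ.1]) hθ.2) (cos_sq_sub_sin_sq_nonneg_of_ge hθ.1 hθ.2) r hr).symm
  -- On the bounding rays `Re (k - iε)² = 0`, so the majorant does not depend on `s`.
  have hlim : ∀ θ, 0 ≤ Real.sin θ → Real.cos θ ^ 2 = Real.sin θ ^ 2 →
      Tendsto (fun s : ℝ => rayIntegral (I * ε) θ (fun k => elem X (t + s) k * P k)) (𝓝[>] 0)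
        (𝓝 (rayIntegral (I * ε) θ (fun k => elem X t k * P k))) := by
    intro θ h1 h2
    refine tendsto_integral_filter_of_dominated_convergence
      (fun r => D * Real.exp (-(c / 2) * r)) ?_ ?_ (integrableOn_const_mul_exp_neg D (half_pos hc))
      ?_
    · exact Eventually.of_forall fun s => ((continuousOn_rayIntegrand fun r _ =>
        (hd s).continuous.continuousAt).mono Ioi_subset_Ici_self).aestronglyMeasurable
          measurableSet_Ioi
    · filter_upwards [Ioc_mem_nhdsGT hs₀] with s hs
      refine (ae_restrict_iff' measurableSet_Ioi).2 (Eventually.of_forall fun r hr => ?_)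
      simpa [rayIntegrand, norm_exp_I_mul] using hray s hs.1.le hs.2 θ h1 h2 r (le_of_lt hr)
    · refine Eventually.of_forall fun r => tendsto_nhdsWithin_of_tendsto_nhds ?_
      have : Continuous fun s : ℝ => rayIntegrand (I * ε) θ (fun k => elem X (t + s) k * P k) r := by
        unfold rayIntegrand elem; fun_prop
      simpa using this.tendsto 0
  refine ⟨fun s hs => ?_, ⟨?_, ?_⟩, ?_⟩
  · have hb := fun a : ℝ => norm_elem_mul_le_of_strip hε.le ht hC hX0 hs hP' a 0 le_rfl hε.le
    simp only [Complex.ofReal_zero, zero_mul, add_zero] at hb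
    exact integrable_of_gaussian_bound (half_pos hs)
      ((hd s).continuous.comp Complex.continuous_ofReal) hb
  · exact rayIntegrable_of_decay (half_pos hc)
      (fun r _ => ((differentiable_elem _ _).mul hPd).continuous.continuousAt)
      (by simpa using hray 0 le_rfl hs₀.le _ hsp hcs)
  · exact rayIntegrable_of_decay (half_pos hc)
      (fun r _ => ((differentiable_elem _ _).mul hPd).continuous.continuousAt)
      (by simpa using hray 0 le_rfl hs₀.le _ hsp3 hcs3)
  · refine ((hlim _ hsp hcs).sub (hlim _ hsp3 hcs3)).congr' ?_
    filter_upwards [Ioc_mem_nhdsGT hs₀] with s hs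
    exact (hdeform s hs.1 hs.2).symm

/-! ### Zeros and lower bound of the denominator `Δ`. -/

theorem Δ_eq (k : ℂ) : Δ k = 2 * I * (k * Complex.cos k - Complex.sin k) := by
  rw [Δ, show -I * k = -k * I by ring, mul_comm I k, Complex.exp_mul_I, Complex.exp_mul_I,
    Complex.cos_neg, Complex.sin_neg]
  linear_combination (-2 * Complex.sin k * k + 2 * Complex.sin k * k) * Complex.I_sq

theorem sinh_lt_self_mul_cosh {b : ℝ} (hb : 0 < b) : Real.sinh b < b * Real.cosh b := by
  have hmono : StrictMonoOn (fun x : ℝ => x * Real.cosh x - Real.sinh x) (Ici 0) := by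
    refine strictMonoOn_of_deriv_pos (convex_Ici 0) (by fun_prop) fun x hx => ?_
    rw [interior_Ici] at hx
    have h1 : HasDerivAt (fun x : ℝ => x * Real.cosh x - Real.sinh x)
        (1 * Real.cosh x + x * Real.sinh x - Real.cosh x) x :=
      ((hasDerivAt_id x).mul (Real.hasDerivAt_cosh x)).sub (Real.hasDerivAt_sinh x)
    rw [h1.deriv]
    have := mul_pos hx (Real.sinh_pos_iff.2 hx)
    linarith
  have := hmono (mem_Ici.2 le_rfl) (mem_Ici.2 hb.le) hb
  simp only [zero_mul, Real.sinh_zero, sub_zero] at this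
  linarith

/-- At a zero, `sin k = k cos k`. Multiplying by twice the conjugate of `cos k` and separating parts
gives, with `k = a + ib` and `M = |cos k|²`, `sin 2a = 2aM` and `sinh 2b = 2bM`. If `b ≠ 0` the
second forces `M > 1`, so the first forces `a = 0`; then `sinh b = b cosh b`, which is impossible
for `b ≠ 0`. -/
theorem Δ_ne_zero {k : ℂ} (hk : k.im ≠ 0) : Δ k ≠ 0 := by
  intro h0
  have hsin : Complex.sin k = k * Complex.cos k := by
    rw [Δ_eq] at h0
    have := (mul_eq_zero.1 h0).resolve_left (by simp)
    linear_combination -this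
  have hprod : Complex.sin (2 * k.re : ℝ) + Complex.sinh (2 * k.im : ℝ) * I
      = 2 * (k * (Complex.normSq (Complex.cos k) : ℝ)) := by
    have e1 := Complex.sin_add k ((starRingEnd ℂ) k)
    have e2 := Complex.sin_sub k ((starRingEnd ℂ) k)
    have hc : Complex.cos ((starRingEnd ℂ) k) = (starRingEnd ℂ) (Complex.cos k) :=
      Complex.cos_conj k
    rw [Complex.add_conj] at e1
    rw [Complex.sub_conj, Complex.sin_mul_I] at e2
    rw [e1, e2, hc, ← Complex.mul_conj, hsin]
    ring
  set M := Complex.normSq (Complex.cos k) with hM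
  have hre : Real.sin (2 * k.re) = 2 * k.re * M := by
    have := congrArg Complex.re hprod
    rw [← Complex.ofReal_sin, ← Complex.ofReal_sinh] at this
    generalize Real.sin (2 * k.re) = S at this ⊢
    generalize Real.sinh (2 * k.im) = S' at this ⊢
    simp at this
    linarith
  have him : Real.sinh (2 * k.im) = 2 * k.im * M := by
    have := congrArg Complex.im hprod
    rw [← Complex.ofReal_sin, ← Complex.ofReal_sinh] at this
    generalize Real.sin (2 * k.re) = S at this ⊢
    generalize Real.sinh (2 * k.im) = S' at this ⊢
    simp at this
    linarith
  have hM0 : 0 ≤ M := Complex.normSq_nonneg _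
  have hM1 : 1 < M := by
    have h1 : 0 < |2 * k.im| := abs_pos.2 (by simpa using hk)
    have h2 := Real.self_lt_sinh_iff.2 h1
    rw [← Real.abs_sinh, him, abs_mul _ M, abs_of_nonneg hM0] at h2
    nlinarith
  have ha : k.re = 0 := by
    by_contra hne
    have h1 : 0 < |2 * k.re| := abs_pos.2 (by simpa using hne)
    have h2 := Real.abs_sin_lt_abs (x := 2 * k.re) (by simpa using hne)
    rw [hre, abs_mul _ M, abs_of_nonneg hM0] at h2
    nlinarith
  have hkI : k = k.im * I := by
    apply Complex.ext <;> simp [ha]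
  have hsc : Real.sinh k.im = k.im * Real.cosh k.im := by
    rw [hkI, Complex.sin_mul_I, Complex.cos_mul_I, ← Complex.ofReal_sinh,
      ← Complex.ofReal_cosh] at hsin
    have := congrArg Complex.im hsin
    generalize Real.sinh k.im = S at this ⊢
    generalize Real.cosh k.im = S' at this ⊢
    simpa using this
  rcases lt_or_gt_of_ne hk with h | h
  · have := sinh_lt_self_mul_cosh (neg_pos.2 h)
    rw [Real.sinh_neg, Real.cosh_neg] at this
    linarith
  · exact (sinh_lt_self_mul_cosh h).ne hsc

theorem Δ_neg (k : ℂ) : Δ (-k) = -Δ k := by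
  rw [Δ_eq, Δ_eq, Complex.cos_neg, Complex.sin_neg]; ring

theorem differentiable_Δ : Differentiable ℂ Δ := by
  unfold Δ; fun_prop

theorem differentiable_h : Differentiable ℂ h := by
  unfold h; fun_prop

theorem norm_exp_neg_I_mul (k : ℂ) : ‖Complex.exp (-I * k)‖ = Real.exp k.im := by
  rw [Complex.norm_exp]; simp

theorem norm_exp_I_mul' (k : ℂ) : ‖Complex.exp (I * k)‖ = Real.exp (-k.im) := by
  rw [Complex.norm_exp]; simp

theorem norm_one_add_I_mul_le (k : ℂ) : ‖1 + I * k‖ ≤ 1 + ‖k‖ := by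
  simpa using norm_add_le (1 : ℂ) (I * k)

theorem norm_one_sub_I_mul_le (k : ℂ) : ‖1 - I * k‖ ≤ 1 + ‖k‖ := by
  simpa using norm_sub_le (1 : ℂ) (I * k)

theorem norm_h_le (k : ℂ) : ‖h k‖ ≤ Real.exp k.im * (1 + ‖k‖) := by
  rw [h, norm_mul, norm_exp_neg_I_mul]
  gcongr
  exact norm_one_add_I_mul_le k

/-- For large `‖k‖` the term with `e^{-ik}` dominates, since the other is smaller by at least `q =
e^{-2ε}` up to lower order. The remaining region is compact and free of zeros. The `5` in `R` makes
`(1 - q)‖k‖` large enough to absorb the lower-order terms. -/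
theorem exists_le_norm_Δ {ε : ℝ} (hε : 0 < ε) :
    ∃ c > 0, ∀ k : ℂ, ε ≤ k.im → c * ((1 + ‖k‖) * Real.exp k.im) ≤ ‖Δ k‖ := by
  set q := Real.exp (-2 * ε) with hq
  have hq0 : 0 < q := Real.exp_pos _
  have hq1 : q < 1 := by rw [hq, Real.exp_lt_one_iff]; linarith
  set R := 5 / (1 - q) with hR
  have hcomp : IsCompact (Metric.closedBall (0 : ℂ) R ∩ {k | ε ≤ k.im}) :=
    (isCompact_closedBall _ _).inter_right (isClosed_le continuous_const Complex.continuous_im)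
  obtain ⟨c, hc0, hc⟩ := hcomp.exists_forall_le' (a := 0)
    (f := fun k => ‖Δ k‖ / ((1 + ‖k‖) * Real.exp k.im))
    (ContinuousOn.div differentiable_Δ.continuous.norm.continuousOn (by fun_prop)
      fun k _ => by positivity)
    (fun k hk => div_pos (norm_pos_iff.2 (Δ_ne_zero (hε.trans_le hk.2).ne')) (by positivity))
  refine ⟨min c ((1 - q) / 2), lt_min hc0 (by linarith), fun k hk => ?_⟩
  by_cases hkR : ‖k‖ ≤ R
  · have := hc k ⟨by simpa using hkR, hk⟩
    rw [le_div_iff₀ (by positivity)] at this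
    refine le_trans ?_ this
    gcongr
    exact min_le_left _ _
  · have h1 : ‖Complex.exp (-I * k) * (1 + I * k)‖ ≥ Real.exp k.im * (‖k‖ - 1) := by
      rw [norm_mul, norm_exp_neg_I_mul]
      gcongr
      have := norm_sub_norm_le (I * k) (-1)
      simp only [norm_mul, Complex.norm_I, one_mul, norm_neg, norm_one, sub_neg_eq_add] at this
      rwa [add_comm] at this
    have h2 : ‖Complex.exp (I * k) * (1 - I * k)‖ ≤ Real.exp k.im * q * (1 + ‖k‖) := by
      rw [norm_mul, norm_exp_I_mul', hq, ← Real.exp_add]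
      gcongr
      · linarith
      · exact norm_one_sub_I_mul_le k
    have h3 := norm_sub_norm_le (Complex.exp (-I * k) * (1 + I * k))
      (Complex.exp (I * k) * (1 - I * k))
    have h4 : 5 < (1 - q) * ‖k‖ := by
      rw [not_le, hR, div_lt_iff₀ (by linarith)] at hkR
      linarith
    calc min c ((1 - q) / 2) * ((1 + ‖k‖) * Real.exp k.im)
        ≤ (1 - q) / 2 * ((1 + ‖k‖) * Real.exp k.im) := by gcongr; exact min_le_right _ _
      _ ≤ Real.exp k.im * (‖k‖ - 1) - Real.exp k.im * q * (1 + ‖k‖) := by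
          have := mul_nonneg (Real.exp_pos k.im).le
            (by linarith : 0 ≤ (1 - q) / 2 * ‖k‖ - 1 - q - (1 - q) / 2)
          nlinarith
      _ ≤ ‖Δ k‖ := by rw [Δ]; linarith

/-! ### Holomorphy and growth of the space and time transforms. -/

theorem differentiable_integral_exp_mul {g : ℝ → ℂ} {T : ℝ}
    (hg : IntervalIntegrable g volume 0 T) :
    Differentiable ℂ fun k : ℂ => ∫ y in (0 : ℝ)..T, Complex.exp (k * y) * g y := by
  intro k₀
  have hm : ∀ k : ℂ, IntervalIntegrable (fun y : ℝ => Complex.exp (k * y) * g y) volume 0 T :=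
    fun k => hg.continuousOn_mul (Continuous.continuousOn (by fun_prop))
  have hm' : IntervalIntegrable (fun y : ℝ => (y : ℂ) * Complex.exp (k₀ * y) * g y) volume 0 T :=
    hg.continuousOn_mul (Continuous.continuousOn (by fun_prop))
  refine (intervalIntegral.hasDerivAt_integral_of_dominated_loc_of_deriv_le
    (F' := fun k y => (y : ℂ) * Complex.exp (k * y) * g y)
    (bound := fun y => |T| * Real.exp ((‖k₀‖ + 1) * |T|) * ‖g y‖)
    (Metric.ball_mem_nhds k₀ one_pos) (Eventually.of_forall fun k => ?_) (hm k₀) ?_ ?_ ?_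
    ?_).2.differentiableAt
  · exact (intervalIntegrable_iff.1 (hm k)).aestronglyMeasurable
  · exact (intervalIntegrable_iff.1 hm').aestronglyMeasurable
  · refine Eventually.of_forall fun y hy k hk => ?_
    have hy' : |y| ≤ |T| := by
      rcases le_total 0 T with h | h
      · rw [uIoc_of_le h] at hy; rw [abs_of_pos hy.1, abs_of_nonneg h]; exact hy.2
      · rw [uIoc_of_ge h] at hy; rw [abs_of_nonpos hy.2, abs_of_nonpos h]; linarith [hy.1]
    have hk' : ‖k‖ ≤ ‖k₀‖ + 1 := by
      have h1 : ‖k - k₀‖ < 1 := by simpa [dist_eq_norm] using hk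
      have h2 := norm_add_le (k - k₀) k₀
      rw [sub_add_cancel] at h2
      linarith
    rw [norm_mul, norm_mul, Complex.norm_exp, Complex.norm_real, Real.norm_eq_abs]
    gcongr
    calc (k * y).re ≤ ‖k * y‖ := Complex.re_le_norm _
      _ = ‖k‖ * |y| := by simp
      _ ≤ _ := by gcongr
  · exact hg.norm.const_mul _
  · refine Eventually.of_forall fun y _ k _ => ?_
    have : HasDerivAt (fun k : ℂ => Complex.exp (k * y)) (Complex.exp (k * y) * (1 * y)) k :=
      ((hasDerivAt_id k).mul_const (y : ℂ)).cexp
    exact (this.mul_const (g y)).congr_deriv (by ring)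

theorem intervalIntegrable_ofReal_of_continuousOn {f : ℝ → ℝ} {a b : ℝ} (hab : a ≤ b)
    (hf : ContinuousOn f (Icc a b)) :
    IntervalIntegrable (fun y => (f y : ℂ)) volume a b :=
  ContinuousOn.intervalIntegrable
    (by rw [uIcc_of_le hab]; exact Complex.continuous_ofReal.comp_continuousOn hf)

theorem intervalIntegrable_ofReal {f : ℝ → ℝ} {a b : ℝ}
    (hf : IntervalIntegrable f volume a b) :
    IntervalIntegrable (fun y => (f y : ℂ)) volume a b :=
  ⟨hf.1.ofReal, hf.2.ofReal⟩

theorem differentiable_spaceTransform {f : ℝ → ℝ} (hf : ContinuousOn f (Icc 0 1)) :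
    Differentiable ℂ (spaceTransform f) :=
  differentiable_integral_exp_mul (intervalIntegrable_ofReal_of_continuousOn zero_le_one hf)

theorem differentiable_timeTransform {f : ℝ → ℝ} {T : ℝ}
    (hf : IntervalIntegrable f volume 0 T) :
    Differentiable ℂ fun k => timeTransform f k T :=
  differentiable_integral_exp_mul (intervalIntegrable_ofReal hf)

theorem norm_spaceTransform_le_of_nonpos {f : ℝ → ℝ} {M : ℝ} (hM : ∀ y ∈ Icc (0 : ℝ) 1, |f y| ≤ M)
    {k : ℂ} (hk : k.re ≤ 0) : ‖spaceTransform f k‖ ≤ M := by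
  have hM0 : 0 ≤ M := (abs_nonneg _).trans (hM 0 (by simp))
  have := intervalIntegral.norm_integral_le_of_norm_le_const (a := 0) (b := 1) (C := M)
    (f := fun y : ℝ => Complex.exp (k * y) * (f y : ℂ)) fun y hy => by
      rw [uIoc_of_le zero_le_one] at hy
      rw [norm_mul, Complex.norm_exp, Complex.norm_real, Real.norm_eq_abs]
      calc _ ≤ 1 * M := by
            gcongr
            · rw [Real.exp_le_one_iff]; simp; nlinarith [hy.1]
            · exact hM y ⟨hy.1.le, hy.2⟩
        _ = M := one_mul M
  simpa [spaceTransform] using this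

theorem norm_spaceTransform_le_of_nonneg {f : ℝ → ℝ} {M : ℝ} (hM : ∀ y ∈ Icc (0 : ℝ) 1, |f y| ≤ M)
    {k : ℂ} (hk : 0 ≤ k.re) : ‖spaceTransform f k‖ ≤ M * Real.exp k.re := by
  have hM0 : 0 ≤ M := (abs_nonneg _).trans (hM 0 (by simp))
  have := intervalIntegral.norm_integral_le_of_norm_le_const (a := 0) (b := 1)
    (C := M * Real.exp k.re)
    (f := fun y : ℝ => Complex.exp (k * y) * (f y : ℂ)) fun y hy => by
      rw [uIoc_of_le zero_le_one] at hy
      rw [norm_mul, Complex.norm_exp, Complex.norm_real, Real.norm_eq_abs, mul_comm M, Complex.re_mul_ofReal]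
      gcongr
      · nlinarith [hy.2]
      · exact hM y ⟨hy.1.le, hy.2⟩
  simpa [spaceTransform] using this

/-- The exponential `e^{τ Re k}` lies below the larger of its endpoint values; their sum serves both
signs of `Re k`. -/
theorem norm_timeTransform_le {f : ℝ → ℝ} {T : ℝ} (hT : 0 ≤ T)
    (hf : IntervalIntegrable f volume 0 T) (k : ℂ) :
    ‖timeTransform f k T‖ ≤ (∫ τ in (0 : ℝ)..T, |f τ|) * (1 + Real.exp (T * k.re)) := by
  rw [timeTransform, mul_comm, ← intervalIntegral.integral_const_mul]
  refine intervalIntegral.norm_integral_le_of_norm_le hT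
    (Eventually.of_forall fun τ hτ => ?_) (hf.abs.const_mul _)
  rw [norm_mul, Complex.norm_exp, Complex.norm_real, Real.norm_eq_abs]
  gcongr
  have : (k * τ).re = τ * k.re := by simp [mul_comm]
  rw [this]
  rcases le_total 0 k.re with h | h
  · have : Real.exp (τ * k.re) ≤ Real.exp (T * k.re) := by gcongr; exact hτ.2
    linarith
  · have h1 : Real.exp (τ * k.re) ≤ 1 := by
      rw [Real.exp_le_one_iff]; exact mul_nonpos_of_nonneg_of_nonpos hτ.1.le h
    have := Real.exp_pos (T * k.re)
    linarith

/-! ### Fourier inversion with Gaussian regularisation. -/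

theorem spaceTransform_eq_integral_indicator (f : ℝ → ℝ) (k : ℂ) :
    spaceTransform f k =
      ∫ y : ℝ, Complex.exp (k * y) * (Icc (0 : ℝ) 1).indicator (fun y => (f y : ℂ)) y := by
  rw [spaceTransform, intervalIntegral.integral_of_le zero_le_one, ← integral_Icc_eq_integral_Ioc,
    ← integral_indicator measurableSet_Icc]
  congr 1
  ext y
  by_cases hy : y ∈ Icc (0 : ℝ) 1 <;> simp [hy]

theorem integral_elem_mul_exp {s : ℝ} (hs : 0 < s) (x y : ℝ) :
    ∫ k : ℝ, elem x s k * Complex.exp (-I * k * y)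
      = (Real.pi / s : ℂ) ^ (1 / 2 : ℂ) * Complex.exp (-(x - y) ^ 2 / (4 * s)) := by
  have := fourierIntegral_gaussian (b := s) (by simpa using hs) (x - y : ℂ)
  rw [← this]
  congr 1
  ext k
  rw [elem, ← Complex.exp_add, ← Complex.exp_add]
  congr 1
  ring

/-- By Fubini the regularised inversion integral is `f`, extended by zero, convolved with a multiple
of the heat kernel. -/
theorem integral_elem_mul_spaceTransform {f : ℝ → ℝ} (hf : ContinuousOn f (Icc 0 1)) {s : ℝ}
    (hs : 0 < s) (x : ℝ) :
    ∫ k : ℝ, elem x s k * spaceTransform f (-I * k)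
      = ∫ y : ℝ, (Real.pi / s : ℂ) ^ (1 / 2 : ℂ) * Complex.exp (-(x - y) ^ 2 / (4 * s)) *
          (Icc (0 : ℝ) 1).indicator (fun y => (f y : ℂ)) y := by
  set F := (Icc (0 : ℝ) 1).indicator (fun y => (f y : ℂ)) with hF
  have hFi : Integrable F := by
    rw [hF, integrable_indicator_iff measurableSet_Icc]
    exact (Complex.continuous_ofReal.comp_continuousOn hf).integrableOn_Icc
  have hprod : Integrable (fun p : ℝ × ℝ => elem x s p.1 * (Complex.exp (-I * p.1 * p.2) * F p.2))
      (volume.prod volume) := by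
    have h1 : Integrable (fun p : ℝ × ℝ => (Real.exp (-s * p.1 ^ 2) : ℂ) * F p.2)
        (volume.prod volume) :=
      Integrable.mul_prod (integrable_exp_neg_mul_sq hs).ofReal hFi
    have h2 : AEStronglyMeasurable (fun p : ℝ × ℝ => Complex.exp (I * p.1 * (x - p.2)))
        (volume.prod volume) := Continuous.aestronglyMeasurable (by fun_prop)
    refine (h1.bdd_mul (c := 1) h2 (Eventually.of_forall fun p => ?_)).congr
      (Eventually.of_forall fun p => ?_)
    · rw [Complex.norm_exp]; simp
    · simp only [elem, Complex.ofReal_exp]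
      rw [← mul_assoc, ← mul_assoc, ← Complex.exp_add, ← Complex.exp_add]
      congr 2
      push_cast
      ring
  simp only [spaceTransform_eq_integral_indicator, ← hF, ← integral_const_mul]
  rw [integral_integral_swap hprod]
  congr 1
  ext y
  rw [← integral_elem_mul_exp hs, ← integral_mul_const]
  congr 1
  ext k
  ring

/-- Pointwise Fourier inversion with Gaussian regularisation. -/
theorem tendsto_integral_elem_mul_spaceTransform {f : ℝ → ℝ} (hf : ContinuousOn f (Icc 0 1))
    {x : ℝ} (hx : x ∈ Ioo (0 : ℝ) 1) :
    Tendsto (fun s : ℝ => ∫ k : ℝ, elem x s k * spaceTransform f (-I * k)) (𝓝[>] 0)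
      (𝓝 (2 * Real.pi * f x)) := by
  set F := (Icc (0 : ℝ) 1).indicator (fun y => (f y : ℂ)) with hF
  have hFi : Integrable F := by
    rw [hF, integrable_indicator_iff measurableSet_Icc]
    exact (Complex.continuous_ofReal.comp_continuousOn hf).integrableOn_Icc
  have hnhds : Icc (0 : ℝ) 1 ∈ 𝓝 x := Icc_mem_nhds hx.1 hx.2
  have hFx : F x = f x := by rw [hF, indicator_of_mem (Ioo_subset_Icc_self hx)]
  have hFc : ContinuousAt F x := by
    have h1 : ContinuousAt (fun y => (f y : ℂ)) x :=
      Complex.continuous_ofReal.continuousAt.comp (hf.continuousAt hnhds)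
    refine h1.congr ?_
    filter_upwards [hnhds] with y hy
    rw [hF, indicator_of_mem hy]
  have hlim := Real.tendsto_integral_gaussian_smul' hFi hFc
  -- The approximate identity is normalised as `(πc)^{1/2} e^{-π²c|x-y|²}`; matching exponents gives
  -- `π²c = 1/(4s)`, and the amplitudes then differ by `2π`.
  have hc : Tendsto (fun s : ℝ => (4 * Real.pi ^ 2)⁻¹ * s⁻¹) (𝓝[>] 0) atTop :=
    tendsto_inv_nhdsGT_zero.const_mul_atTop (by positivity)
  have := (hlim.comp hc).const_mul (2 * Real.pi : ℂ)
  rw [hFx] at this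
  refine this.congr' ?_
  filter_upwards [self_mem_nhdsWithin] with s (hs : 0 < s)
  rw [integral_elem_mul_spaceTransform hf hs, ← hF]
  simp only [Function.comp, smul_eq_mul]
  rw [← integral_const_mul]
  congr 1
  ext y
  have hpi : (Real.pi : ℂ) ≠ 0 := by exact_mod_cast Real.pi_ne_zero
  have hs' : (s : ℂ) ≠ 0 := by exact_mod_cast hs.ne'
  have h1 : (Real.pi / s : ℂ) ^ (1 / 2 : ℂ) = 2 * Real.pi *
      (Real.pi * (((4 * Real.pi ^ 2)⁻¹ * s⁻¹ : ℝ) : ℂ)) ^ (1 / 2 : ℂ) := by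
    have e1 : (Real.pi / s : ℂ) = ((2 * Real.pi) ^ 2 : ℝ) *
        (Real.pi * ((4 * Real.pi ^ 2)⁻¹ * s⁻¹) : ℝ) := by
      push_cast
      field_simp
      norm_num
    have e2 : (((2 * Real.pi) ^ 2 : ℝ) : ℂ) ^ (1 / 2 : ℂ) = 2 * Real.pi := by
      rw [show (1 / 2 : ℂ) = ((1 / 2 : ℝ) : ℂ) by push_cast; rfl,
        ← Complex.ofReal_cpow (by positivity), ← Real.sqrt_eq_rpow,
        Real.sqrt_sq (by positivity)]
      push_cast; rfl
    rw [e1, Complex.mul_cpow_ofReal_nonneg (by positivity) (by positivity), e2]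
    push_cast
    rfl
  have h2 : -(Real.pi : ℂ) ^ 2 * (((4 * Real.pi ^ 2)⁻¹ * s⁻¹ : ℝ) : ℂ) * (‖x - y‖ : ℂ) ^ 2
      = -(x - y) ^ 2 / (4 * s) := by
    have e : (‖x - y‖ : ℂ) ^ 2 = (x - y : ℂ) ^ 2 := by
      rw [Real.norm_eq_abs]; exact_mod_cast congrArg (fun r : ℝ => (r : ℂ)) (sq_abs (x - y))
    rw [e]
    push_cast
    field_simp
  rw [h2, h1]
  simp only [Module.finrank_self, Nat.cast_one]
  ring

/-! ### Parameter integrals and the boundary term at `x = 0`. -/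

/-- Clamping both variables with `projIcc` makes the integrand globally continuous without changing
it on the rectangle. -/
theorem continuousOn_integral_of_continuousOn {F : ℝ → ℝ → ℂ} {a b c d : ℝ} (hab : a ≤ b)
    (hcd : c ≤ d) (hF : ContinuousOn (fun p : ℝ × ℝ => F p.1 p.2) (Icc a b ×ˢ Icc c d)) :
    ContinuousOn (fun y => ∫ τ in c..d, F y τ) (Icc a b) := by
  have hG : Continuous (Function.uncurry fun y τ : ℝ =>
      F (projIcc a b hab y) (projIcc c d hcd τ)) := by
    refine hF.comp_continuous
      (f := fun p : ℝ × ℝ => ((projIcc a b hab p.1 : ℝ), (projIcc c d hcd p.2 : ℝ)))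
      (by fun_prop) fun p => ⟨(projIcc a b hab p.1).2, (projIcc c d hcd p.2).2⟩
  refine (intervalIntegral.continuous_parametric_intervalIntegral_of_continuous' hG c d
    (μ := volume)).continuousOn.congr fun y hy => ?_
  refine intervalIntegral.integral_congr fun τ hτ => ?_
  rw [uIcc_of_le hcd] at hτ
  simp only [projIcc_of_mem hab hy, projIcc_of_mem hcd hτ]

theorem hasDerivAt_integral_of_continuousOn {F F' : ℝ → ℝ → ℂ} {a b c d : ℝ} (hcd : c ≤ d)
    (hF : ∀ y ∈ Ioo a b, ContinuousOn (F y) (Icc c d))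
    (hF' : ContinuousOn (fun p : ℝ × ℝ => F' p.1 p.2) (Ioo a b ×ˢ Icc c d))
    (hd : ∀ y ∈ Ioo a b, ∀ τ ∈ Icc c d, HasDerivAt (fun y => F y τ) (F' y τ) y)
    {y : ℝ} (hy : y ∈ Ioo a b) :
    HasDerivAt (fun y => ∫ τ in c..d, F y τ) (∫ τ in c..d, F' y τ) y := by
  obtain ⟨η, hη, hsub⟩ := Metric.nhds_basis_closedBall.mem_iff.1 (Ioo_mem_nhds hy.1 hy.2)
  obtain ⟨B, hB⟩ := ((isCompact_closedBall y η).prod isCompact_Icc).exists_bound_of_continuousOn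
    (hF'.mono (prod_mono hsub (Subset.refl (Icc c d))))
  have hi : ∀ z ∈ Ioo a b, IntervalIntegrable (F z) volume c d := fun z hz =>
    ContinuousOn.intervalIntegrable (by rw [uIcc_of_le hcd]; exact hF z hz)
  have hi' : IntervalIntegrable (F' y) volume c d := by
    refine ContinuousOn.intervalIntegrable ?_
    rw [uIcc_of_le hcd]
    exact hF'.comp (f := fun τ => (y, τ)) (by fun_prop) fun τ hτ => ⟨hy, hτ⟩
  refine (intervalIntegral.hasDerivAt_integral_of_dominated_loc_of_deriv_le
    (bound := fun _ => B) (Metric.closedBall_mem_nhds y hη) ?_ (hi y hy) ?_ ?_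
    intervalIntegrable_const ?_).2
  · filter_upwards [Ioo_mem_nhds hy.1 hy.2] with z hz
    exact (intervalIntegrable_iff.1 (hi z hz)).aestronglyMeasurable
  · exact (intervalIntegrable_iff.1 hi').aestronglyMeasurable
  · refine Eventually.of_forall fun τ hτ z hz => ?_
    rw [uIoc_of_le hcd] at hτ
    exact hB (z, τ) ⟨hz, hτ.1.le, hτ.2⟩
  · refine Eventually.of_forall fun τ hτ z hz => ?_
    rw [uIoc_of_le hcd] at hτ
    exact hd z (hsub hz) τ ⟨hτ.1.le, hτ.2⟩

/-- If `φ V' - φ' V` has a limit at `0+`, where `φ(0) = V(0) = 0`, then the limit is zero. -/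
theorem eq_zero_of_tendsto_wronskian {φ φ' V V' : ℝ → ℂ} {L : ℂ}
    (hφ : ∀ y, HasDerivAt φ (φ' y) y) (hφ' : Continuous φ') (hφ0 : φ 0 = 0)
    (hV : ∀ y ∈ Ioo (0 : ℝ) 1, HasDerivAt V (V' y) y) (hV0 : Tendsto V (𝓝[>] 0) (𝓝 0))
    (hL : Tendsto (fun y => φ y * V' y - φ' y * V y) (𝓝[>] 0) (𝓝 L)) : L = 0 := by
  set W : ℝ → ℂ := fun y => if y = 0 then 0 else φ y * V y with hW
  have hpos : Ioo (0 : ℝ) 1 ∈ 𝓝[>] (0 : ℝ) := Ioo_mem_nhdsGT one_pos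
  have hWeq : ∀ y : ℝ, y ≠ 0 → W =ᶠ[𝓝 y] fun y => φ y * V y := fun y hy => by
    filter_upwards [isOpen_ne.mem_nhds hy] with z hz
    simp only [hW, if_neg hz]
  have hWd : ∀ y ∈ Ioo (0 : ℝ) 1, HasDerivAt W (φ' y * V y + φ y * V' y) y := fun y hy =>
    ((hφ y).mul (hV y hy)).congr_of_eventuallyEq (hWeq y hy.1.ne')
  have hφt : Tendsto φ (𝓝[>] 0) (𝓝 0) := by
    have := (hφ 0).continuousAt.tendsto
    rw [hφ0] at this
    exact this.mono_left nhdsWithin_le_nhds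
  have hφ't : Tendsto φ' (𝓝[>] 0) (𝓝 (φ' 0)) := (hφ'.tendsto 0).mono_left nhdsWithin_le_nhds
  have hW0 : W 0 = 0 := by simp [hW]
  -- For `W = φV`, `W' = (φV' - φ'V) + 2φ'V` tends to `L`, so `L` is the one-sided derivative of `W`
  -- at `0`.
  have h1 : HasDerivWithinAt W L (Ici 0) 0 := by
    refine hasDerivWithinAt_Ici_of_tendsto_deriv (s := Ioo 0 1)
      (fun y hy => (hWd y hy).differentiableAt.differentiableWithinAt) ?_ hpos ?_
    · rw [ContinuousWithinAt, hW0]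
      have := (hφt.mul hV0)
      rw [mul_zero] at this
      refine (this.mono_left (nhdsWithin_mono _ Ioo_subset_Ioi_self)).congr' ?_
      filter_upwards [self_mem_nhdsWithin] with y hy
      simp only [hW, if_neg hy.1.ne']
    · have := hL.add ((hφ't.mul hV0).const_mul 2)
      rw [mul_zero, mul_zero, add_zero] at this
      refine this.congr' ?_
      filter_upwards [hpos] with y hy
      rw [(hWd y hy).deriv]
      ring
  -- Computed directly, the difference quotient is `(φ(y)/y) V(y)`, which tends to `φ'(0) · 0`;
  -- nothing about `V'` near `0` is required.
  have h2 : HasDerivWithinAt W 0 (Ici 0) 0 := by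
    rw [hasDerivWithinAt_iff_tendsto_slope, Ici_sdiff_left]
    have hs : Tendsto (slope φ 0) (𝓝[>] 0) (𝓝 (φ' 0)) :=
      (hasDerivAt_iff_tendsto_slope.1 (hφ 0)).mono_left
        (nhdsWithin_mono _ fun y (hy : 0 < y) => hy.ne')
    have := hs.mul hV0
    rw [mul_zero] at this
    refine this.congr' ?_
    filter_upwards [self_mem_nhdsWithin] with y (hy : 0 < y)
    simp only [slope, hW, if_neg hy.ne', hφ0, vsub_eq_sub, sub_zero, if_true, smul_mul_assoc]
  exact (uniqueDiffWithinAt_Ici 0).eq_deriv _ h1 h2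

/-! ### The global relation. -/

namespace IsClassicalSolution

variable {u₀ j : ℝ → ℝ} {u : ℝ → ℝ → ℝ}

theorem continuousOn_slice (hu : IsClassicalSolution u₀ j u) {T : ℝ} (hT : 0 ≤ T) :
    ContinuousOn (fun x => u x T) (Icc 0 1) :=
  hu.continuousOn.comp (f := fun x => (x, T)) (by fun_prop) fun _ hx => ⟨hx, hT⟩

theorem continuousOn_time (hu : IsClassicalSolution u₀ j u) {x : ℝ} (hx : x ∈ Icc (0 : ℝ) 1) :
    ContinuousOn (fun τ => u x τ) (Ici 0) :=
  hu.continuousOn.comp (f := fun τ => (x, τ)) (by fun_prop) fun _ hτ => ⟨hx, hτ⟩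

theorem continuousOn_initial (hu : IsClassicalSolution u₀ j u) : ContinuousOn u₀ (Icc 0 1) :=
  (hu.continuousOn_slice le_rfl).congr fun x hx => (hu.initial x hx).symm

theorem hasDerivAt_x (hu : IsClassicalSolution u₀ j u) {x t : ℝ} (hx : x ∈ Ioo (0 : ℝ) 1)
    (ht : 0 < t) :
    HasDerivAt (fun y => u y t) (derivWithin (fun y => u y t) (Icc 0 1) x) x :=
  (hu.differentiable_x x ⟨hx.1, hx.2.le⟩ t ht).hasDerivWithinAt.hasDerivAt
    (Icc_mem_nhds hx.1 hx.2)

theorem hasDerivAt_xx (hu : IsClassicalSolution u₀ j u) {x t : ℝ} (hx : x ∈ Ioo (0 : ℝ) 1)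
    (ht : 0 < t) :
    HasDerivAt (fun y => derivWithin (fun y' => u y' t) (Icc 0 1) y)
      (deriv (fun s => u x s) t) x := by
  refine (hu.heat x hx t ht).congr_of_eventuallyEq ?_
  filter_upwards [Ioo_mem_nhds hx.1 hx.2] with y hy
  exact (hu.hasDerivAt_x hy ht).deriv.symm

/-- Green's identity for `φ = sin(ky)` and `V(y) = ∫ e^{k²τ} u(y,τ) dτ`: since `φ'' = -k²φ`, the
Wronskian `φV' - φ'V` has derivative `φ (V'' + k²V)`, in which only the time endpoints survive.
Starting at `δ > 0` avoids the derivatives of `u` near `t = 0`. -/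
theorem wronskian_eq (hu : IsClassicalSolution u₀ j u) (k : ℂ) {δ t : ℝ} (hδ : 0 < δ)
    (hδt : δ ≤ t) :
    Complex.sin k * (∫ τ in δ..t, Complex.exp (k ^ 2 * τ) *
        (derivWithin (fun y => u y τ) (Icc 0 1) 1 : ℝ))
      - k * Complex.cos k * (∫ τ in δ..t, Complex.exp (k ^ 2 * τ) * (u 1 τ : ℂ))
      = ∫ y in (0 : ℝ)..1, Complex.sin (k * y) *
          (Complex.exp (k ^ 2 * t) * u y t - Complex.exp (k ^ 2 * δ) * u y δ) := by
  set ux : ℝ → ℝ → ℝ := fun y τ => derivWithin (fun y => u y τ) (Icc 0 1) y with hux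
  set ut : ℝ → ℝ → ℝ := fun y τ => deriv (fun s => u y s) τ with hut
  set V : ℝ → ℂ := fun y => ∫ τ in δ..t, Complex.exp (k ^ 2 * τ) * (u y τ : ℂ) with hV
  set V' : ℝ → ℂ := fun y => ∫ τ in δ..t, Complex.exp (k ^ 2 * τ) * (ux y τ : ℂ) with hV'
  set g : ℝ → ℂ := fun y => Complex.sin (k * y) *
    (Complex.exp (k ^ 2 * t) * u y t - Complex.exp (k ^ 2 * δ) * u y δ) with hg
  have ht0 : 0 < t := hδ.trans_le hδt
  have hpos : ∀ τ ∈ Icc δ t, 0 < τ := fun τ hτ => hδ.trans_le hτ.1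
  have hec : ∀ S : Set (ℝ × ℝ), ContinuousOn (fun p : ℝ × ℝ => Complex.exp (k ^ 2 * p.2)) S :=
    fun S => Continuous.continuousOn (by fun_prop)
  have huc : ContinuousOn (fun p : ℝ × ℝ => Complex.exp (k ^ 2 * p.2) * (u p.1 p.2 : ℂ))
      (Icc 0 1 ×ˢ Icc δ t) :=
    (hec _).mul (Complex.continuous_ofReal.comp_continuousOn
      (hu.continuousOn.mono (prod_mono Subset.rfl fun τ hτ => (hpos τ hτ).le)))
  have huxc : ContinuousOn (fun p : ℝ × ℝ => Complex.exp (k ^ 2 * p.2) * (ux p.1 p.2 : ℂ))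
      (Ioc 0 1 ×ˢ Icc δ t) :=
    (hec _).mul (Complex.continuous_ofReal.comp_continuousOn
      (hu.continuousOn_x.mono (prod_mono Subset.rfl fun τ hτ => hpos τ hτ)))
  have hutc : ContinuousOn (fun p : ℝ × ℝ => Complex.exp (k ^ 2 * p.2) * (ut p.1 p.2 : ℂ))
      (Ioo 0 1 ×ˢ Icc δ t) :=
    (hec _).mul (Complex.continuous_ofReal.comp_continuousOn
      (hu.continuousOn_t.mono (prod_mono Subset.rfl fun τ hτ => hpos τ hτ)))
  have hVd : ∀ y ∈ Ioo (0 : ℝ) 1, HasDerivAt V (V' y) y := fun y hy =>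
    hasDerivAt_integral_of_continuousOn (a := 0) (b := 1)
      (F := fun y τ => Complex.exp (k ^ 2 * τ) * (u y τ : ℂ))
      (F' := fun y τ => Complex.exp (k ^ 2 * τ) * (ux y τ : ℂ)) hδt
      (fun z hz => huc.comp (f := fun τ => (z, τ)) (by fun_prop)
        fun τ hτ => ⟨Ioo_subset_Icc_self hz, hτ⟩)
      (huxc.mono (prod_mono Ioo_subset_Ioc_self Subset.rfl))
      (fun z hz τ hτ => (hu.hasDerivAt_x hz (hpos τ hτ)).ofReal_comp.const_mul _) hy
  have hV'd : ∀ y ∈ Ioo (0 : ℝ) 1, HasDerivAt V'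
      (∫ τ in δ..t, Complex.exp (k ^ 2 * τ) * (ut y τ : ℂ)) y := fun y hy =>
    hasDerivAt_integral_of_continuousOn (a := 0) (b := 1)
      (F := fun y τ => Complex.exp (k ^ 2 * τ) * (ux y τ : ℂ))
      (F' := fun y τ => Complex.exp (k ^ 2 * τ) * (ut y τ : ℂ)) hδt
      (fun z hz => huxc.comp (f := fun τ => (z, τ)) (by fun_prop)
        fun τ hτ => ⟨Ioo_subset_Ioc_self hz, hτ⟩) hutc
      (fun z hz τ hτ => (hu.hasDerivAt_xx hz (hpos τ hτ)).ofReal_comp.const_mul _) hy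
  -- Integration by parts in time: by the heat equation the left side is `V''`.
  have hparts : ∀ y ∈ Ioo (0 : ℝ) 1, ∫ τ in δ..t, Complex.exp (k ^ 2 * τ) * (ut y τ : ℂ)
      = Complex.exp (k ^ 2 * t) * u y t - Complex.exp (k ^ 2 * δ) * u y δ - k ^ 2 * V y := by
    intro y hy
    have hi1 : IntervalIntegrable (fun τ : ℝ => Complex.exp (k ^ 2 * τ) * (u y τ : ℂ)) volume δ t :=
      ContinuousOn.intervalIntegrable (by
        rw [uIcc_of_le hδt]
        exact huc.comp (f := fun τ => (y, τ)) (by fun_prop)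
          fun τ hτ => ⟨Ioo_subset_Icc_self hy, hτ⟩)
    have hi2 : IntervalIntegrable (fun τ : ℝ => Complex.exp (k ^ 2 * τ) * (ut y τ : ℂ))
        volume δ t :=
      ContinuousOn.intervalIntegrable (by
        rw [uIcc_of_le hδt]
        exact hutc.comp (f := fun τ => (y, τ)) (by fun_prop) fun τ hτ => ⟨hy, hτ⟩)
    have := intervalIntegral.integral_eq_sub_of_hasDerivAt (a := δ) (b := t)
      (f := fun τ : ℝ => Complex.exp (k ^ 2 * τ) * (u y τ : ℂ))
      (f' := fun τ : ℝ => k ^ 2 * (Complex.exp (k ^ 2 * τ) * (u y τ : ℂ))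
        + Complex.exp (k ^ 2 * τ) * (ut y τ : ℂ)) (fun τ hτ => by
        rw [uIcc_of_le hδt] at hτ
        have h1 : HasDerivAt (fun τ : ℝ => Complex.exp (k ^ 2 * τ))
            (Complex.exp (k ^ 2 * τ) * (k ^ 2 * 1)) τ :=
          ((Complex.ofRealCLM.hasDerivAt (x := τ)).const_mul (k ^ 2)).cexp
        have h2 : HasDerivAt (fun τ : ℝ => (u y τ : ℂ)) (ut y τ : ℂ) τ :=
          (hu.differentiable_t y hy τ (hpos τ hτ)).hasDerivAt.ofReal_comp
        exact (h1.mul h2).congr_deriv (by ring)) ((hi1.const_mul _).add hi2)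
    rw [intervalIntegral.integral_add (hi1.const_mul _) hi2,
      intervalIntegral.integral_const_mul] at this
    linear_combination this
  have hVc : ContinuousOn V (Icc 0 1) :=
    continuousOn_integral_of_continuousOn zero_le_one hδt huc
  have hV'c : ∀ a : ℝ, 0 < a → a ≤ 1 → ContinuousOn V' (Icc a 1) := fun a ha ha1 =>
    continuousOn_integral_of_continuousOn ha1 hδt
      (huxc.mono (prod_mono (fun y hy => ⟨ha.trans_le hy.1, hy.2⟩) Subset.rfl))
  have hgc : ContinuousOn g (Icc 0 1) := by
    have h1 := Complex.continuous_ofReal.comp_continuousOn (hu.continuousOn_slice ht0.le)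
    have h2 := Complex.continuous_ofReal.comp_continuousOn (hu.continuousOn_slice hδ.le)
    exact (Continuous.continuousOn (by fun_prop)).mul
      ((continuousOn_const.mul h1).sub (continuousOn_const.mul h2))
  set φ : ℝ → ℂ := fun y => Complex.sin (k * y) with hφ
  set φ' : ℝ → ℂ := fun y => k * Complex.cos (k * y) with hφ'
  have hlin : ∀ y : ℝ, HasDerivAt (fun y : ℝ => k * (y : ℂ)) (k * 1) y := fun y =>
    (Complex.ofRealCLM.hasDerivAt (x := y)).const_mul k
  have hφd : ∀ y, HasDerivAt φ (φ' y) y := fun y => by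
    have h1 : HasDerivAt φ (Complex.cos (k * y) * (k * 1)) y :=
      HasDerivAt.comp (h₂ := Complex.sin) y (Complex.hasDerivAt_sin (k * y)) (hlin y)
    exact h1.congr_deriv (by simp only [hφ']; ring)
  have hφ'd : ∀ y, HasDerivAt φ' (-k ^ 2 * φ y) y := fun y => by
    have h1 : HasDerivAt φ' (k * (-Complex.sin (k * y) * (k * 1))) y :=
      (HasDerivAt.comp (h₂ := Complex.cos) y (Complex.hasDerivAt_cos (k * y)) (hlin y)).const_mul k
    exact h1.congr_deriv (by simp only [hφ]; ring)
  have hφ'c : Continuous φ' := by fun_prop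
  set Q : ℝ → ℂ := fun y => φ y * V' y - φ' y * V y with hQ
  have hQd : ∀ y ∈ Ioo (0 : ℝ) 1, HasDerivAt Q (g y) y := fun y hy => by
    refine (((hφd y).mul (hV'd y hy)).sub ((hφ'd y).mul (hVd y hy))).congr_deriv ?_
    rw [hparts y hy]
    simp only [hg, hφ]
    ring
  have hφc : Continuous φ := by fun_prop
  have hQint : ∀ a ∈ Ioc (0 : ℝ) 1, Q a = Q 1 - ∫ y in a..1, g y := by
    intro a ha
    rw [intervalIntegral.integral_eq_sub_of_hasDerivAt_of_le (f := Q) ha.2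
      ((hφc.continuousOn.mul (hV'c a ha.1 ha.2)).sub
        (hφ'c.continuousOn.mul (hVc.mono (Icc_subset_Icc_left ha.1.le))))
      (fun y hy => hQd y ⟨ha.1.trans hy.1, hy.2⟩)
      (ContinuousOn.intervalIntegrable (by
        rw [uIcc_of_le ha.2]; exact hgc.mono (Icc_subset_Icc_left ha.1.le)))]
    ring
  -- `V'` is not controlled at `0`, but `Q' = g` is continuous up to `0`, so `Q` has a limit there;
  -- `eq_zero_of_tendsto_wronskian` identifies it as zero.
  have hQlim : Tendsto Q (𝓝[>] 0) (𝓝 (Q 1 - ∫ y in (0 : ℝ)..1, g y)) := by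
    have hp := intervalIntegral.continuousOn_primitive_interval_left (μ := volume) (f := g)
      (a := 0) (b := 1) (by rw [uIcc_of_le zero_le_one]; exact hgc.integrableOn_Icc)
    rw [uIcc_of_le zero_le_one] at hp
    have h0 := (hp 0 (by simp)).tendsto.mono_left
      (nhdsWithin_le_of_mem (Icc_mem_nhdsGT one_pos : Icc (0 : ℝ) 1 ∈ 𝓝[>] 0))
    refine (h0.const_sub (Q 1)).congr' ?_
    filter_upwards [Ioc_mem_nhdsGT one_pos] with a ha
    exact (hQint a ha).symm
  have hV0 : Tendsto V (𝓝[>] 0) (𝓝 0) := by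
    have h0 : V 0 = 0 := by
      simp only [hV]
      rw [intervalIntegral.integral_congr (g := fun _ => (0 : ℂ))]
      · simp
      · intro τ hτ
        rw [uIcc_of_le hδt] at hτ
        simp [hu.dirichlet τ (hpos τ hτ)]
    rw [← h0]
    exact (hVc 0 (by simp)).tendsto.mono_left
      (nhdsWithin_le_of_mem (Icc_mem_nhdsGT one_pos : Icc (0 : ℝ) 1 ∈ 𝓝[>] 0))
  have hfin := eq_zero_of_tendsto_wronskian hφd hφ'c (by simp [hφ]) hVd hV0 hQlim
  have : Q 1 = ∫ y in (0 : ℝ)..1, g y := sub_eq_zero.1 hfin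
  simpa [hQ, hφ, hφ', hV, hV', hux] using this

theorem intervalIntegrable_boundary (hu : IsClassicalSolution u₀ j u) {t : ℝ} (ht : 0 ≤ t) :
    IntervalIntegrable (fun τ => u 1 τ) volume 0 t :=
  ContinuousOn.intervalIntegrable (by
    rw [uIcc_of_le ht]
    exact (hu.continuousOn_time (by simp)).mono Icc_subset_Ici_self)

theorem tendsto_integral_exp_mul {f : ℝ → ℝ} {t : ℝ} (ht : 0 < t)
    (hf : IntervalIntegrable f volume 0 t) (k : ℂ) :
    Tendsto (fun δ : ℝ => ∫ τ in δ..t, Complex.exp (k * τ) * (f τ : ℂ)) (𝓝[>] 0)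
      (𝓝 (timeTransform f k t)) := by
  have hi : IntervalIntegrable (fun τ : ℝ => Complex.exp (k * τ) * (f τ : ℂ)) volume 0 t :=
    (intervalIntegrable_ofReal hf).continuousOn_mul
      (Continuous.continuousOn (by fun_prop))
  have hp := intervalIntegral.continuousOn_primitive_interval_left
    ((intervalIntegrable_iff' (by finiteness)).1 hi)
  rw [uIcc_of_le ht.le] at hp
  exact (hp 0 (by simp [ht.le])).tendsto.mono_left
    (nhdsWithin_le_of_mem (Icc_mem_nhdsGT ht))

/-- The limit `δ → 0` of `wronskian_eq`. The Robin condition first replaces `u_x(1,·)` by `j +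
u(1,·)`, which is integrable down to `t = 0`. -/
theorem sine_relation (hu : IsClassicalSolution u₀ j u) (k : ℂ) {t : ℝ} (ht : 0 < t)
    (hj : IntervalIntegrable j volume 0 t) :
    Complex.sin k * timeTransform j (k ^ 2) t
      + (Complex.sin k - k * Complex.cos k) * timeTransform (fun τ => u 1 τ) (k ^ 2) t
      = Complex.exp (k ^ 2 * t) * (∫ y in (0 : ℝ)..1, Complex.sin (k * y) * (u y t : ℂ))
        - ∫ y in (0 : ℝ)..1, Complex.sin (k * y) * (u₀ y : ℂ) := by
  set S : ℝ → ℂ := fun τ => ∫ y in (0 : ℝ)..1, Complex.sin (k * y) * (u y τ : ℂ) with hS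
  have hSi : ∀ τ, 0 ≤ τ → IntervalIntegrable (fun y : ℝ => Complex.sin (k * y) * (u y τ : ℂ))
      volume 0 1 := fun τ hτ =>
    (intervalIntegrable_ofReal_of_continuousOn zero_le_one
      (hu.continuousOn_slice hτ)).continuousOn_mul (Continuous.continuousOn (by fun_prop))
  have hS0 : S 0 = ∫ y in (0 : ℝ)..1, Complex.sin (k * y) * (u₀ y : ℂ) := by
    refine intervalIntegral.integral_congr fun y hy => ?_
    rw [uIcc_of_le zero_le_one] at hy
    simp only [hu.initial y hy]
  have hSc : ContinuousOn S (Icc 0 t) := by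
    refine continuousOn_integral_of_continuousOn ht.le zero_le_one ?_
    refine ContinuousOn.mul (Continuous.continuousOn (by fun_prop)) ?_
    exact Complex.continuous_ofReal.comp_continuousOn
      (hu.continuousOn.comp (f := fun p : ℝ × ℝ => (p.2, p.1)) (by fun_prop)
        fun p hp => ⟨hp.2, hp.1.1⟩)
  have hw := hu.intervalIntegrable_boundary ht.le
  have hleft := ((tendsto_integral_exp_mul ht hj (k ^ 2)).const_mul (Complex.sin k)).add
    ((tendsto_integral_exp_mul ht hw (k ^ 2)).const_mul (Complex.sin k - k * Complex.cos k))
  have hexp : Tendsto (fun δ : ℝ => Complex.exp (k ^ 2 * δ)) (𝓝[>] 0) (𝓝 1) := by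
    have : Continuous fun δ : ℝ => Complex.exp (k ^ 2 * δ) := by fun_prop
    simpa using (this.tendsto 0).mono_left nhdsWithin_le_nhds
  have hright := (hexp.mul ((hSc 0 (by simp [ht.le])).tendsto.mono_left
    (nhdsWithin_le_of_mem (Icc_mem_nhdsGT ht)))).const_sub (Complex.exp (k ^ 2 * t) * S t)
  rw [one_mul] at hright
  rw [← hS0]
  refine tendsto_nhds_unique hleft (hright.congr' ?_)
  filter_upwards [Ioc_mem_nhdsGT ht] with δ hδ
  have hsub : uIcc δ t ⊆ uIcc 0 t := by
    rw [uIcc_of_le hδ.2, uIcc_of_le ht.le]; exact Icc_subset_Icc_left hδ.1.le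
  have hi : ∀ f : ℝ → ℝ, IntervalIntegrable f volume 0 t →
      IntervalIntegrable (fun τ : ℝ => Complex.exp (k ^ 2 * τ) * (f τ : ℂ)) volume δ t :=
    fun f hf => (intervalIntegrable_ofReal (hf.mono_set hsub)).continuousOn_mul
      (Continuous.continuousOn (by fun_prop))
  have hrob : ∫ τ in δ..t, Complex.exp (k ^ 2 * τ) *
        (derivWithin (fun y => u y τ) (Icc 0 1) 1 : ℝ)
      = (∫ τ in δ..t, Complex.exp (k ^ 2 * τ) * (j τ : ℂ))
        + ∫ τ in δ..t, Complex.exp (k ^ 2 * τ) * (u 1 τ : ℂ) := by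
    rw [← intervalIntegral.integral_add (hi j hj) (hi _ hw)]
    refine intervalIntegral.integral_congr fun τ hτ => ?_
    rw [uIcc_of_le hδ.2] at hτ
    have := hu.robin τ (hδ.1.trans_le hτ.1)
    simp only [show derivWithin (fun y => u y τ) (Icc 0 1) 1 = j τ + u 1 τ by linarith]
    push_cast
    ring
  have hkey := hu.wronskian_eq k hδ.1 hδ.2
  rw [hrob] at hkey
  have hsplit : ∫ y in (0 : ℝ)..1, Complex.sin (k * y) *
      (Complex.exp (k ^ 2 * t) * u y t - Complex.exp (k ^ 2 * δ) * u y δ)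
      = Complex.exp (k ^ 2 * t) * S t - Complex.exp (k ^ 2 * δ) * S δ := by
    simp only [hS]
    rw [← intervalIntegral.integral_const_mul, ← intervalIntegral.integral_const_mul,
      ← intervalIntegral.integral_sub ((hSi t ht.le).const_mul _) ((hSi δ hδ.1.le).const_mul _)]
    refine intervalIntegral.integral_congr fun y _ => ?_
    ring
  rw [hsplit] at hkey
  linear_combination -hkey

theorem spaceTransform_sub {f : ℝ → ℝ} (hf : ContinuousOn f (Icc 0 1)) (k : ℂ) :
    spaceTransform f (-I * k) - spaceTransform f (I * k)
      = -2 * I * ∫ y in (0 : ℝ)..1, Complex.sin (k * y) * (f y : ℂ) := by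
  have hi : ∀ z : ℂ, IntervalIntegrable (fun y : ℝ => Complex.exp (z * y) * (f y : ℂ))
      volume 0 1 := fun z => (intervalIntegrable_ofReal_of_continuousOn zero_le_one hf).continuousOn_mul
        (Continuous.continuousOn (by fun_prop))
  rw [spaceTransform, spaceTransform, ← intervalIntegral.integral_sub (hi _) (hi _),
    ← intervalIntegral.integral_const_mul]
  refine intervalIntegral.integral_congr fun y _ => ?_
  rw [show -I * k * y = -(k * y) * I by ring, show I * k * y = (k * y) * I by ring,
    Complex.exp_mul_I, Complex.exp_mul_I, Complex.cos_neg, Complex.sin_neg]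
  ring

/-- The global relation, with the unknown flux at `x = 0` eliminated. -/
theorem global_relation (hu : IsClassicalSolution u₀ j u) (k : ℂ) {t : ℝ} (ht : 0 < t)
    (hj : IntervalIntegrable j volume 0 t) :
    Complex.exp (k ^ 2 * t) * (spaceTransform (fun x => u x t) (-I * k)
        - spaceTransform (fun x => u x t) (I * k))
      = spaceTransform u₀ (-I * k) - spaceTransform u₀ (I * k)
        + (Complex.exp (-I * k) - Complex.exp (I * k)) * timeTransform j (k ^ 2) t
        + Δ k * timeTransform (fun τ => u 1 τ) (k ^ 2) t := by
  have hs := hu.sine_relation k ht hj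
  rw [spaceTransform_sub (hu.continuousOn_slice ht.le), spaceTransform_sub hu.continuousOn_initial,
    Δ_eq, show -I * k = -k * I by ring, mul_comm I k, Complex.exp_mul_I, Complex.exp_mul_I,
    Complex.cos_neg, Complex.sin_neg]
  linear_combination (2 * I) * hs

end IsClassicalSolution

/-! ### The boundary fluxes and their expression through the data. -/

noncomputable section

/-- The flux transform `∫₀ᵗ e^{k² s} u_x(0,s) ds` at `x = 0`, expressed through the other terms of
the global relation, so that no regularity of `u_x` at `x = 0` is needed. -/
def leftFlux (u₀ j : ℝ → ℝ) (u : ℝ → ℝ → ℝ) (t : ℝ) (k : ℂ) : ℂ :=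
  spaceTransform u₀ (-I * k) + Complex.exp (-I * k) * timeTransform j (k ^ 2) t
    + h k * timeTransform (fun τ => u 1 τ) (k ^ 2) t
    - Complex.exp (k ^ 2 * t) * spaceTransform (fun x => u x t) (-I * k)

/-- The contribution `∫₀ᵗ e^{k² s} (u_x(1,s) - ik u(1,s)) ds` of the side `x = 1`. -/
def rightFlux (j : ℝ → ℝ) (u : ℝ → ℝ → ℝ) (t : ℝ) (k : ℂ) : ℂ :=
  timeTransform j (k ^ 2) t + (1 - I * k) * timeTransform (fun τ => u 1 τ) (k ^ 2) t

end

theorem exp_neg_I_mul_mul_exp (k : ℂ) : Complex.exp (-I * k) * Complex.exp (I * k) = 1 := by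
  rw [← Complex.exp_add]; simp

theorem h_neg (k : ℂ) : h (-k) = Complex.exp (I * k) * (1 - I * k) := by
  rw [h]; congr 2 <;> ring

/-- The reflection exchanges the roles of the two ends; the factor `e^{-ik}` cancels against the
exponentials carried by the terms at `x = 1`. -/
theorem elem_neg (x t : ℝ) (k : ℂ) :
    elem x t (-k) = elem (1 - x) t k * Complex.exp (-I * k) := by
  rw [elem, elem, ← Complex.exp_add]
  congr 1
  push_cast
  ring

theorem norm_spaceTransform_I_mul_le {f : ℝ → ℝ} {M : ℝ} (hM : ∀ y ∈ Icc (0 : ℝ) 1, |f y| ≤ M)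
    {k : ℂ} (hk : 0 ≤ k.im) : ‖spaceTransform f (I * k)‖ ≤ M :=
  norm_spaceTransform_le_of_nonpos hM (by simpa using hk)

theorem norm_spaceTransform_neg_I_mul_le {f : ℝ → ℝ} {M : ℝ}
    (hM : ∀ y ∈ Icc (0 : ℝ) 1, |f y| ≤ M) {k : ℂ} (hk : 0 ≤ k.im) :
    ‖spaceTransform f (-I * k)‖ ≤ M * Real.exp k.im := by
  simpa using norm_spaceTransform_le_of_nonneg hM (k := -I * k) (by simpa using hk)

theorem norm_spaceTransform_sub_le {f : ℝ → ℝ} {M : ℝ} (hM : ∀ y ∈ Icc (0 : ℝ) 1, |f y| ≤ M)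
    {k : ℂ} (hk : 0 ≤ k.im) :
    ‖spaceTransform f (I * k) - spaceTransform f (-I * k)‖ ≤ 2 * M * Real.exp k.im := by
  have hM0 : 0 ≤ M := (abs_nonneg _).trans (hM 0 (by simp))
  have h1 := norm_spaceTransform_I_mul_le hM hk
  have h2 := norm_spaceTransform_neg_I_mul_le hM hk
  have h3 : M * 1 ≤ M * Real.exp k.im := by gcongr; exact Real.one_le_exp hk
  linarith [norm_sub_le (spaceTransform f (I * k)) (spaceTransform f (-I * k))]

/-- In each product one factor carries `e^{Im k}` and the other stays free of it, so the growth
matches the lower bound of `exists_le_norm_Δ`. -/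
theorem norm_h_mul_spaceTransform_sub_le {f : ℝ → ℝ} {M : ℝ}
    (hM : ∀ y ∈ Icc (0 : ℝ) 1, |f y| ≤ M) {k : ℂ} (hk : 0 ≤ k.im) :
    ‖h k * spaceTransform f (I * k) - h (-k) * spaceTransform f (-I * k)‖
      ≤ 2 * M * ((1 + ‖k‖) * Real.exp k.im) := by
  have hM0 : 0 ≤ M := (abs_nonneg _).trans (hM 0 (by simp))
  have h1 := norm_spaceTransform_I_mul_le hM hk
  have h2 := norm_spaceTransform_neg_I_mul_le hM hk
  have h3 : ‖h k * spaceTransform f (I * k)‖ ≤ Real.exp k.im * (1 + ‖k‖) * M := by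
    rw [norm_mul]
    gcongr
    exact norm_h_le k
  have h4 : ‖h (-k) * spaceTransform f (-I * k)‖ ≤ 1 * (1 + ‖k‖) * (M * Real.exp k.im) := by
    rw [norm_mul]
    gcongr
    refine (norm_h_le (-k)).trans ?_
    rw [norm_neg]
    gcongr
    rw [Real.exp_le_one_iff]
    simpa using hk
  linarith [norm_sub_le (h k * spaceTransform f (I * k)) (h (-k) * spaceTransform f (-I * k))]

theorem norm_exp_sq_mul (k : ℂ) (t : ℝ) :
    ‖Complex.exp (k ^ 2 * t)‖ = Real.exp (t * (k ^ 2).re) := by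
  rw [Complex.norm_exp, Complex.re_mul_ofReal, mul_comm]

/-- The identity is asked only in the open upper half-plane, which contains `∂D₊` and where division
by `Δ` is legitimate. -/
theorem integralBoundaryPlus_of_eq_sub {f g g' : ℂ → ℂ} {ε : ℝ} (hε : 0 < ε)
    (hg : IntegrableBoundaryPlus ε g) (hg' : IntegrableBoundaryPlus ε g')
    (hf : ∀ k : ℂ, 0 < k.im → f k = g k - g' k) :
    IntegrableBoundaryPlus ε f ∧
      integralBoundaryPlus ε f = integralBoundaryPlus ε g - integralBoundaryPlus ε g' := by
  have key : ∀ θ : ℝ, 0 ≤ Real.sin θ → EqOn (rayIntegrand (I * ε) θ f)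
      (fun r => rayIntegrand (I * ε) θ g r - rayIntegrand (I * ε) θ g' r) (Ioi 0) := by
    intro θ hθ r hr
    have : 0 < (I * ε + r * Complex.exp (I * θ)).im := by
      rw [ray_im]; have := mul_nonneg (le_of_lt (mem_Ioi.1 hr)) hθ; linarith
    simp only [rayIntegrand, hf _ this, sub_mul]
  have hπ := Real.pi_pos
  have k1 := key (Real.pi / 4) (Real.sin_nonneg_of_nonneg_of_le_pi (by linarith) (by linarith))
  have k2 := key (3 * Real.pi / 4) (Real.sin_nonneg_of_nonneg_of_le_pi (by linarith) (by linarith))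
  refine ⟨⟨?_, ?_⟩, ?_⟩
  · exact (integrableOn_congr_fun k1 measurableSet_Ioi).2 (hg.1.sub hg'.1)
  · exact (integrableOn_congr_fun k2 measurableSet_Ioi).2 (hg.2.sub hg'.2)
  · simp only [integralBoundaryPlus, rayIntegral]
    rw [setIntegral_congr_fun measurableSet_Ioi k1, setIntegral_congr_fun measurableSet_Ioi k2,
      integral_sub hg.1 hg'.1, integral_sub hg.2 hg'.2]
    ring

theorem ν₁Future_neg (u : ℝ → ℝ → ℝ) (T : ℝ) (k : ℂ) : ν₁Future u T (-k) = -ν₁Future u T k := by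
  simp only [ν₁Future, mul_neg, neg_mul, neg_neg, neg_sq]
  ring

namespace IsClassicalSolution

variable {u₀ j : ℝ → ℝ} {u : ℝ → ℝ → ℝ}

theorem exists_bound_slice (hu : IsClassicalSolution u₀ j u) {T : ℝ} (hT : 0 ≤ T) :
    ∃ M, ∀ y ∈ Icc (0 : ℝ) 1, |u y T| ≤ M :=
  isCompact_Icc.exists_bound_of_continuousOn (hu.continuousOn_slice hT)

theorem exists_bound_initial (hu : IsClassicalSolution u₀ j u) :
    ∃ M, ∀ y ∈ Icc (0 : ℝ) 1, |u₀ y| ≤ M :=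
  isCompact_Icc.exists_bound_of_continuousOn hu.continuousOn_initial

/-- After multiplication by `Δ`, the global relation times `h` removes the transform of the unknown
`u(1,·)`; only the data and the slice at time `t` remain. -/
theorem Δ_mul_leftFlux (hu : IsClassicalSolution u₀ j u) (k : ℂ) {t : ℝ} (ht : 0 < t)
    (hj : IntervalIntegrable j volume 0 t) :
    Δ k * leftFlux u₀ j u t k = μ₀ u₀ j t k + ν₀Future u t k := by
  have hr := hu.global_relation k ht hj
  have hE := exp_neg_I_mul_mul_exp k
  simp only [leftFlux, μ₀, ν₀Future, h_neg]
  simp only [Δ, h] at hr ⊢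
  generalize timeTransform j (k ^ 2) t = J at *
  generalize timeTransform (fun τ => u 1 τ) (k ^ 2) t = g at *
  generalize Complex.exp (-I * k) = E at *
  generalize Complex.exp (I * k) = E' at *
  linear_combination (-(E * (1 + I * k))) * hr + (2 * I * k * J) * hE

theorem Δ_mul_rightFlux (hu : IsClassicalSolution u₀ j u) (k : ℂ) {t : ℝ} (ht : 0 < t)
    (hj : IntervalIntegrable j volume 0 t) :
    Δ k * rightFlux j u t k = 2 * I * k * Complex.exp (-I * k) * timeTransform j (k ^ 2) t
      + (1 - I * k) * (spaceTransform u₀ (I * k) - spaceTransform u₀ (-I * k))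
      - (1 - I * k) * (Complex.exp (k ^ 2 * t) * (spaceTransform (fun x => u x t) (I * k)
        - spaceTransform (fun x => u x t) (-I * k))) := by
  have hr := hu.global_relation k ht hj
  simp only [rightFlux]
  simp only [Δ] at hr ⊢
  linear_combination (-(1 - I * k)) * hr

/-- The same flux written at `-k`, the form in which it meets the integral over `∂D₋`. -/
theorem Δ_mul_rightFlux' (hu : IsClassicalSolution u₀ j u) (k : ℂ) {t : ℝ} (ht : 0 < t)
    (hj : IntervalIntegrable j volume 0 t) :
    Δ k * rightFlux j u t k
      = -(Complex.exp (-I * k) * (μ₁ u₀ j t (-k) + h (-k) * ν₁Future u t (-k))) := by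
  rw [hu.Δ_mul_rightFlux k ht hj, ν₁Future_neg]
  have hE := exp_neg_I_mul_mul_exp k
  simp only [μ₁, μ₀, ν₁Future, h_neg, Δ_neg, neg_sq]
  simp only [Δ, mul_neg]
  simp only [neg_mul, neg_neg] at *
  generalize Complex.exp (-(I * k)) = E at *
  generalize Complex.exp (I * k) = E' at *
  generalize spaceTransform u₀ (I * k) = a at *
  generalize spaceTransform u₀ (-(I * k)) = b at *
  generalize spaceTransform (fun x => u x t) (I * k) = A at *
  generalize spaceTransform (fun x => u x t) (-(I * k)) = B at *
  linear_combination ((1 - I * k) * (b - a) + (1 - I * k) * (A - B) * Complex.exp (k ^ 2 * t)) * hE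

theorem differentiable_spaceTransform_slice (hu : IsClassicalSolution u₀ j u) {T : ℝ} (hT : 0 ≤ T)
    (z : ℂ) : Differentiable ℂ fun k => spaceTransform (fun x => u x T) (z * k) :=
  (differentiable_spaceTransform (hu.continuousOn_slice hT)).comp (by fun_prop)

theorem differentiable_leftFlux (hu : IsClassicalSolution u₀ j u) {t : ℝ} (ht : 0 ≤ t)
    (hj : IntervalIntegrable j volume 0 t) : Differentiable ℂ (leftFlux u₀ j u t) := by
  have h1 : Differentiable ℂ fun k => spaceTransform u₀ (-I * k) :=
    (differentiable_spaceTransform hu.continuousOn_initial).comp (by fun_prop)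
  have h2 := hu.differentiable_spaceTransform_slice ht (-I)
  have h3 : Differentiable ℂ fun k => timeTransform j (k ^ 2) t :=
    (differentiable_timeTransform hj).comp (f := fun k : ℂ => k ^ 2) (by fun_prop)
  have h4 : Differentiable ℂ fun k => timeTransform (fun τ => u 1 τ) (k ^ 2) t :=
    (differentiable_timeTransform (hu.intervalIntegrable_boundary ht)).comp
      (f := fun k : ℂ => k ^ 2) (by fun_prop)
  exact ((h1.add (Differentiable.mul (by fun_prop) h3)).add (differentiable_h.mul h4)).sub
    (Differentiable.mul (by fun_prop) h2)

theorem differentiable_rightFlux (hu : IsClassicalSolution u₀ j u) {t : ℝ} (ht : 0 ≤ t)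
    (hj : IntervalIntegrable j volume 0 t) : Differentiable ℂ (rightFlux j u t) := by
  have h3 : Differentiable ℂ fun k => timeTransform j (k ^ 2) t :=
    (differentiable_timeTransform hj).comp (f := fun k : ℂ => k ^ 2) (by fun_prop)
  have h4 : Differentiable ℂ fun k => timeTransform (fun τ => u 1 τ) (k ^ 2) t :=
    (differentiable_timeTransform (hu.intervalIntegrable_boundary ht)).comp
      (f := fun k : ℂ => k ^ 2) (by fun_prop)
  exact h3.add (Differentiable.mul (by fun_prop) h4)

/-! ### Growth of the fluxes in the upper half-plane. -/

/-- Bounds for `leftFlux` in the upper half-plane. -/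
theorem exists_norm_leftFlux_le (hu : IsClassicalSolution u₀ j u) {t ε : ℝ} (ht : 0 < t)
    (hj : IntervalIntegrable j volume 0 t) (hε : 0 < ε) :
    ∃ C, 0 ≤ C ∧
      (∀ k : ℂ, ε ≤ k.im → ‖leftFlux u₀ j u t k‖ ≤ C * (1 + Real.exp (t * (k ^ 2).re))) ∧
      ∀ k : ℂ, 0 ≤ k.im → k.im ≤ ε →
        ‖leftFlux u₀ j u t k‖ ≤ C * (1 + ‖k‖) * (1 + Real.exp (t * (k ^ 2).re)) := by
  obtain ⟨M₀, hM₀⟩ := hu.exists_bound_initial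
  obtain ⟨M, hM⟩ := hu.exists_bound_slice ht.le
  have hM₀0 : 0 ≤ M₀ := (abs_nonneg _).trans (hM₀ 0 (by simp))
  have hM0 : 0 ≤ M := (abs_nonneg _).trans (hM 0 (by simp))
  obtain ⟨c, hc0, hc⟩ := exists_le_norm_Δ hε
  have hJ := norm_timeTransform_le ht.le hj
  have hW := norm_timeTransform_le ht.le (hu.intervalIntegrable_boundary ht.le)
  set J := ∫ τ in (0 : ℝ)..t, |j τ| with hJdef
  set W := ∫ τ in (0 : ℝ)..t, |u 1 τ| with hWdef
  have hJ0 : 0 ≤ J := intervalIntegral.integral_nonneg ht.le fun _ _ => abs_nonneg _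
  have hW0 : 0 ≤ W := intervalIntegral.integral_nonneg ht.le fun _ _ => abs_nonneg _
  -- The first summand comes from dividing by `Δ` where `Im k ≥ ε`. The second comes from the
  -- definition of `leftFlux` in the strip, where `Δ` may vanish; the explicit `u(1,·)` term there
  -- costs the factor `1 + ‖k‖`.
  refine ⟨(2 * M₀ + 2 * J + 2 * M) / c + Real.exp ε * (M₀ + J + W + M), by positivity,
    fun k hk => ?_, fun k hk0 hkε => ?_⟩
  · have hk0 : 0 ≤ k.im := hε.le.trans hk
    set X := Real.exp (t * (k ^ 2).re) with hX
    have hX0 : 0 < X := Real.exp_pos _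
    set N := (1 + ‖k‖) * Real.exp k.im with hN
    have hN0 : 0 < N := by positivity
    have e : Δ k * leftFlux u₀ j u t k =
        (h k * spaceTransform u₀ (I * k) - h (-k) * spaceTransform u₀ (-I * k))
        + 2 * I * k * timeTransform j (k ^ 2) t
        - (h k * spaceTransform (fun x => u x t) (I * k)
          - h (-k) * spaceTransform (fun x => u x t) (-I * k)) * Complex.exp (k ^ 2 * t) := by
      rw [hu.Δ_mul_leftFlux k ht hj, μ₀, ν₀Future]
      simp only [h_neg]
      simp only [h]
      ring
    have b1 := norm_h_mul_spaceTransform_sub_le hM₀ hk0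
    have b2 : ‖(h k * spaceTransform (fun x => u x t) (I * k)
          - h (-k) * spaceTransform (fun x => u x t) (-I * k)) * Complex.exp (k ^ 2 * t)‖
        ≤ 2 * M * N * X := by
      rw [norm_mul, norm_exp_sq_mul]
      gcongr
      exact norm_h_mul_spaceTransform_sub_le hM hk0
    have b3 : ‖2 * I * k * timeTransform j (k ^ 2) t‖ ≤ 2 * N * (J * (1 + X)) := by
      rw [norm_mul]
      have : ‖2 * I * k‖ ≤ 2 * N := by
        have h1 : 1 ≤ Real.exp k.im := Real.one_le_exp hk0
        simp only [norm_mul, Complex.norm_ofNat, Complex.norm_I, mul_one]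
        nlinarith [norm_nonneg k]
      gcongr
      exact hJ _
    have hup : ‖Δ k‖ * ‖leftFlux u₀ j u t k‖ ≤ N * ((2 * M₀ + 2 * J + 2 * M) * (1 + X)) := by
      rw [← norm_mul, e]
      refine (norm_sub_le _ _).trans ?_
      have := norm_add_le (h k * spaceTransform u₀ (I * k) - h (-k) * spaceTransform u₀ (-I * k))
        (2 * I * k * timeTransform j (k ^ 2) t)
      nlinarith [mul_nonneg (mul_nonneg hM₀0 hN0.le) hX0.le, mul_nonneg hM0 hN0.le]
    have hlow : c * N * ‖leftFlux u₀ j u t k‖ ≤ ‖Δ k‖ * ‖leftFlux u₀ j u t k‖ := by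
      gcongr
      exact hc k hk
    have h5 : ‖leftFlux u₀ j u t k‖ ≤ (2 * M₀ + 2 * J + 2 * M) / c * (1 + X) := by
      rw [div_mul_eq_mul_div, le_div_iff₀ hc0]
      refine le_of_mul_le_mul_left ?_ hN0
      linarith
    refine h5.trans ?_
    gcongr
    have : 0 ≤ Real.exp ε * (M₀ + J + W + M) := by positivity
    linarith
  · set X := Real.exp (t * (k ^ 2).re) with hX
    have hX0 : 0 < X := Real.exp_pos _
    have hE : Real.exp k.im ≤ Real.exp ε := Real.exp_le_exp.2 hkε
    have b1 : ‖spaceTransform u₀ (-I * k)‖ ≤ M₀ * Real.exp ε :=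
      (norm_spaceTransform_neg_I_mul_le hM₀ hk0).trans (by gcongr)
    have b2 : ‖Complex.exp (-I * k) * timeTransform j (k ^ 2) t‖
        ≤ Real.exp ε * (J * (1 + X)) := by
      rw [norm_mul, norm_exp_neg_I_mul]
      gcongr
      exact hJ _
    have b3 : ‖h k * timeTransform (fun τ => u 1 τ) (k ^ 2) t‖
        ≤ Real.exp ε * (1 + ‖k‖) * (W * (1 + X)) := by
      rw [norm_mul]
      gcongr
      · exact (norm_h_le k).trans (by gcongr)
      · exact hW _
    have b4 : ‖Complex.exp (k ^ 2 * t) * spaceTransform (fun x => u x t) (-I * k)‖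
        ≤ X * (M * Real.exp ε) := by
      rw [norm_mul, norm_exp_sq_mul]
      gcongr
      exact (norm_spaceTransform_neg_I_mul_le hM hk0).trans (by gcongr)
    have hsum : ‖leftFlux u₀ j u t k‖ ≤ M₀ * Real.exp ε + Real.exp ε * (J * (1 + X))
        + Real.exp ε * (1 + ‖k‖) * (W * (1 + X)) + X * (M * Real.exp ε) := by
      rw [leftFlux]
      refine (norm_sub_le _ _).trans (add_le_add ?_ b4)
      exact (norm_add_le _ _).trans (add_le_add ((norm_add_le _ _).trans (add_le_add b1 b2)) b3)
    have n0 := norm_nonneg k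
    calc ‖leftFlux u₀ j u t k‖ ≤ _ := hsum
      _ ≤ M₀ * Real.exp ε * ((1 + ‖k‖) * (1 + X)) + Real.exp ε * J * ((1 + ‖k‖) * (1 + X))
        + Real.exp ε * W * ((1 + ‖k‖) * (1 + X)) + M * Real.exp ε * ((1 + ‖k‖) * (1 + X)) := by
          have p1 : 1 ≤ (1 + ‖k‖) * (1 + X) := by nlinarith
          have p2 : 1 + X ≤ (1 + ‖k‖) * (1 + X) := by nlinarith
          have p3 : X ≤ (1 + ‖k‖) * (1 + X) := by linarith
          have q1 := mul_le_mul_of_nonneg_left p1 (by positivity : 0 ≤ M₀ * Real.exp ε)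
          have q2 := mul_le_mul_of_nonneg_left p2 (by positivity : 0 ≤ Real.exp ε * J)
          have q3 := mul_le_mul_of_nonneg_left p3 (by positivity : 0 ≤ M * Real.exp ε)
          nlinarith
      _ = (Real.exp ε * (M₀ + J + W + M)) * (1 + ‖k‖) * (1 + X) := by ring
      _ ≤ _ := by
          gcongr
          have : 0 ≤ (2 * M₀ + 2 * J + 2 * M) / c := by positivity
          linarith

/-- Bounds for `rightFlux` in the upper half-plane. -/
theorem exists_norm_rightFlux_le (hu : IsClassicalSolution u₀ j u) {t ε : ℝ} (ht : 0 < t)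
    (hj : IntervalIntegrable j volume 0 t) (hε : 0 < ε) :
    ∃ C, 0 ≤ C ∧
      (∀ k : ℂ, ε ≤ k.im → ‖rightFlux j u t k‖ ≤ C * (1 + Real.exp (t * (k ^ 2).re))) ∧
      ∀ k : ℂ, 0 ≤ k.im → k.im ≤ ε →
        ‖rightFlux j u t k‖ ≤ C * (1 + ‖k‖) * (1 + Real.exp (t * (k ^ 2).re)) := by
  obtain ⟨M₀, hM₀⟩ := hu.exists_bound_initial
  obtain ⟨M, hM⟩ := hu.exists_bound_slice ht.le
  have hM₀0 : 0 ≤ M₀ := (abs_nonneg _).trans (hM₀ 0 (by simp))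
  have hM0 : 0 ≤ M := (abs_nonneg _).trans (hM 0 (by simp))
  obtain ⟨c, hc0, hc⟩ := exists_le_norm_Δ hε
  have hJ := norm_timeTransform_le ht.le hj
  have hW := norm_timeTransform_le ht.le (hu.intervalIntegrable_boundary ht.le)
  set J := ∫ τ in (0 : ℝ)..t, |j τ| with hJdef
  set W := ∫ τ in (0 : ℝ)..t, |u 1 τ| with hWdef
  have hJ0 : 0 ≤ J := intervalIntegral.integral_nonneg ht.le fun _ _ => abs_nonneg _
  have hW0 : 0 ≤ W := intervalIntegral.integral_nonneg ht.le fun _ _ => abs_nonneg _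
  -- The same two regimes: division by `Δ` above height `ε`, the definition of `rightFlux` in the
  -- strip.
  refine ⟨(2 * M₀ + 2 * J + 2 * M) / c + (J + W), by positivity,
    fun k hk => ?_, fun k hk0 hkε => ?_⟩
  · have hk0 : 0 ≤ k.im := hε.le.trans hk
    set X := Real.exp (t * (k ^ 2).re) with hX
    have hX0 : 0 < X := Real.exp_pos _
    set N := (1 + ‖k‖) * Real.exp k.im with hN
    have hN0 : 0 < N := by positivity
    have hl := norm_one_sub_I_mul_le k
    have b1 : ‖(1 - I * k) * (spaceTransform u₀ (I * k) - spaceTransform u₀ (-I * k))‖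
        ≤ 2 * M₀ * N := by
      rw [norm_mul]
      calc _ ≤ (1 + ‖k‖) * (2 * M₀ * Real.exp k.im) := by
            gcongr
            exact norm_spaceTransform_sub_le hM₀ hk0
        _ = _ := by rw [hN]; ring
    have b2 : ‖(1 - I * k) * (Complex.exp (k ^ 2 * t) * (spaceTransform (fun x => u x t) (I * k)
        - spaceTransform (fun x => u x t) (-I * k)))‖ ≤ 2 * M * N * X := by
      rw [norm_mul, norm_mul, norm_exp_sq_mul]
      calc _ ≤ (1 + ‖k‖) * (X * (2 * M * Real.exp k.im)) := by
            gcongr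
            exact norm_spaceTransform_sub_le hM hk0
        _ = _ := by rw [hN]; ring
    have b3 : ‖2 * I * k * Complex.exp (-I * k) * timeTransform j (k ^ 2) t‖
        ≤ 2 * N * (J * (1 + X)) := by
      rw [norm_mul]
      have : ‖2 * I * k * Complex.exp (-I * k)‖ ≤ 2 * N := by
        rw [norm_mul, norm_exp_neg_I_mul]
        simp only [norm_mul, Complex.norm_ofNat, Complex.norm_I, mul_one]
        nlinarith [norm_nonneg k, Real.exp_pos k.im]
      gcongr
      exact hJ _
    have hup : ‖Δ k‖ * ‖rightFlux j u t k‖ ≤ N * ((2 * M₀ + 2 * J + 2 * M) * (1 + X)) := by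
      rw [← norm_mul, hu.Δ_mul_rightFlux k ht hj]
      refine (norm_sub_le _ _).trans ?_
      have := norm_add_le (2 * I * k * Complex.exp (-I * k) * timeTransform j (k ^ 2) t)
        ((1 - I * k) * (spaceTransform u₀ (I * k) - spaceTransform u₀ (-I * k)))
      nlinarith [mul_nonneg (mul_nonneg hM₀0 hN0.le) hX0.le, mul_nonneg hM0 hN0.le]
    have hlow : c * N * ‖rightFlux j u t k‖ ≤ ‖Δ k‖ * ‖rightFlux j u t k‖ := by
      gcongr
      exact hc k hk
    have h5 : ‖rightFlux j u t k‖ ≤ (2 * M₀ + 2 * J + 2 * M) / c * (1 + X) := by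
      rw [div_mul_eq_mul_div, le_div_iff₀ hc0]
      refine le_of_mul_le_mul_left ?_ hN0
      linarith
    refine h5.trans ?_
    gcongr
    linarith
  · set X := Real.exp (t * (k ^ 2).re) with hX
    have hX0 : 0 < X := Real.exp_pos _
    have b3 : ‖(1 - I * k) * timeTransform (fun τ => u 1 τ) (k ^ 2) t‖
        ≤ (1 + ‖k‖) * (W * (1 + X)) := by
      rw [norm_mul]
      gcongr
      · exact norm_one_sub_I_mul_le k
      · exact hW _
    have hsum : ‖rightFlux j u t k‖ ≤ J * (1 + X) + (1 + ‖k‖) * (W * (1 + X)) := by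
      rw [rightFlux]
      exact (norm_add_le _ _).trans (add_le_add (hJ _) b3)
    calc ‖rightFlux j u t k‖ ≤ _ := hsum
      _ ≤ (J + W) * (1 + ‖k‖) * (1 + X) := by
          have := mul_nonneg (mul_nonneg hJ0 (norm_nonneg k)) (by linarith : 0 ≤ 1 + X)
          nlinarith
      _ ≤ _ := by
          refine mul_le_mul_of_nonneg_right (mul_le_mul_of_nonneg_right ?_ (by positivity))
            (by positivity)
          have : 0 ≤ (2 * M₀ + 2 * J + 2 * M) / c := by positivity
          linarith

/-! ### Vanishing of the future time slice. -/

/-- The bracket in `ν₀Future` divided by `Δ` is bounded for `Im k ≥ ε`, the time exponentials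
combine to `e^{k²(T-t)}`, bounded where `Re k² ≤ 0`, and `e^{ikx}` with `x > 0` supplies the decay
that closes the contour. -/
theorem future_plus (hu : IsClassicalSolution u₀ j u) {x t T ε : ℝ} (hx : 0 < x) (ht : 0 ≤ t)
    (hT : t ≤ T) (hε : 0 < ε) :
    IntegrableBoundaryPlus ε (fun k => elem x t k / Δ k * ν₀Future u T k) ∧
      integralBoundaryPlus ε (fun k => elem x t k / Δ k * ν₀Future u T k) = 0 := by
  have hT0 := ht.trans hT
  obtain ⟨M, hM⟩ := hu.exists_bound_slice hT0
  have hM0 : 0 ≤ M := (abs_nonneg _).trans (hM 0 (by simp))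
  obtain ⟨c, hc0, hc⟩ := exists_le_norm_Δ hε
  refine integralBoundaryPlus_eq_zero (C := 2 * M / c) hε (by positivity) hx
    (fun k hk => ?_) fun k hk hρ => ?_
  · have hν : Differentiable ℂ (ν₀Future u T) :=
      (((differentiable_h.mul (hu.differentiable_spaceTransform_slice hT0 I)).sub
        ((differentiable_h.comp differentiable_neg).mul
          (hu.differentiable_spaceTransform_slice hT0 (-I)))).neg).mul (by fun_prop)
    exact ((differentiable_elem x t k).div (differentiable_Δ k) (Δ_ne_zero hk.ne')).mul (hν k)
  · have hk0 : 0 ≤ k.im := hε.le.trans hk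
    have hN0 : 0 < (1 + ‖k‖) * Real.exp k.im := by positivity
    have b1 := norm_h_mul_spaceTransform_sub_le hM hk0
    have hr : ‖h k * spaceTransform (fun x => u x T) (I * k)
        - h (-k) * spaceTransform (fun x => u x T) (-I * k)‖ / ‖Δ k‖ ≤ 2 * M / c := by
      rw [div_le_div_iff₀ ((by positivity : 0 < c * _).trans_le (hc k hk)) hc0]
      calc _ ≤ 2 * M * ((1 + ‖k‖) * Real.exp k.im) * c := by gcongr
        _ = 2 * M * (c * ((1 + ‖k‖) * Real.exp k.im)) := by ring
        _ ≤ _ := by gcongr; exact hc k hk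
    rw [ν₀Future, norm_mul, norm_div, norm_mul, norm_neg, norm_elem, norm_exp_sq_mul]
    calc _ = ‖h k * spaceTransform (fun x => u x T) (I * k)
        - h (-k) * spaceTransform (fun x => u x T) (-I * k)‖ / ‖Δ k‖ *
          (Real.exp (-x * k.im) * Real.exp ((T - t) * (k ^ 2).re)) := by
          rw [Real.exp_sub, sub_mul, Real.exp_sub]
          ring
      _ ≤ 2 * M / c * (Real.exp (-x * k.im) * 1) := by
          gcongr
          rw [Real.exp_le_one_iff]
          exact mul_nonpos_of_nonneg_of_nonpos (by linarith) hρ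
      _ = _ := by rw [mul_one]

/-- After `k ↦ -k` the `e^{-ik}` from `elem_neg` cancels the exponential in `h(-k)`. What remains is
estimated as in `future_plus`, with `1 - x` as the decay rate. -/
theorem future_minus (hu : IsClassicalSolution u₀ j u) {x t T ε : ℝ} (hx : x < 1) (ht : 0 ≤ t)
    (hT : t ≤ T) (hε : 0 < ε) :
    IntegrableBoundaryMinus ε (fun k => elem x t k / Δ k * (h k * ν₁Future u T k)) ∧
      integralBoundaryMinus ε (fun k => elem x t k / Δ k * (h k * ν₁Future u T k)) = 0 := by
  have hT0 := ht.trans hT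
  obtain ⟨M, hM⟩ := hu.exists_bound_slice hT0
  have hM0 : 0 ≤ M := (abs_nonneg _).trans (hM 0 (by simp))
  obtain ⟨c, hc0, hc⟩ := exists_le_norm_Δ hε
  rw [integrableBoundaryMinus_iff, integralBoundaryMinus_eq, neg_eq_zero]
  refine integralBoundaryPlus_eq_zero (C := 2 * M / c) (c := 1 - x) hε (by positivity)
    (by linarith) (fun k hk => ?_) fun k hk hρ => ?_
  · have hν : Differentiable ℂ (ν₁Future u T) :=
      (((hu.differentiable_spaceTransform_slice hT0 I).sub
        (hu.differentiable_spaceTransform_slice hT0 (-I))).neg).mul (by fun_prop)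
    have hd : DifferentiableAt ℂ (fun k => elem x t k / Δ k * (h k * ν₁Future u T k)) (-k) :=
      ((differentiable_elem x t _).div (differentiable_Δ _)
        (Δ_ne_zero (by simpa using hk.ne'))).mul ((differentiable_h _).mul (hν _))
    exact DifferentiableAt.comp (f := fun k : ℂ => -k) k hd differentiable_neg.differentiableAt
  · have hk0 : 0 ≤ k.im := hε.le.trans hk
    have hN0 : 0 < (1 + ‖k‖) * Real.exp k.im := by positivity
    have b1 := norm_spaceTransform_sub_le hM hk0
    have hl := norm_one_sub_I_mul_le k
    have hΔ0 : 0 < ‖Δ k‖ := (by positivity : 0 < c * _).trans_le (hc k hk)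
    have hr : ‖1 - I * k‖ * ‖spaceTransform (fun x => u x T) (I * k)
        - spaceTransform (fun x => u x T) (-I * k)‖ / ‖Δ k‖ ≤ 2 * M / c := by
      rw [div_le_div_iff₀ hΔ0 hc0]
      calc _ ≤ (1 + ‖k‖) * (2 * M * Real.exp k.im) * c := by gcongr
        _ = 2 * M * (c * ((1 + ‖k‖) * Real.exp k.im)) := by ring
        _ ≤ _ := by gcongr; exact hc k hk
    have e : elem x t (-k) / Δ (-k) * (h (-k) * ν₁Future u T (-k))
        = elem (1 - x) t k / Δ k * ((1 - I * k) * ν₁Future u T k) := by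
      rw [elem_neg, Δ_neg, ν₁Future_neg, h_neg]
      linear_combination (elem (1 - x) t k / Δ k * ((1 - I * k) * ν₁Future u T k)) *
        exp_neg_I_mul_mul_exp k
    simp only [e]
    rw [ν₁Future, norm_mul, norm_div, norm_mul, norm_mul, norm_neg, norm_elem, norm_exp_sq_mul]
    calc _ = ‖1 - I * k‖ * ‖spaceTransform (fun x => u x T) (I * k)
        - spaceTransform (fun x => u x T) (-I * k)‖ / ‖Δ k‖ *
          (Real.exp (-(1 - x) * k.im) * Real.exp ((T - t) * (k ^ 2).re)) := by
          rw [Real.exp_sub, sub_mul T, Real.exp_sub]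
          ring
      _ ≤ 2 * M / c * (Real.exp (-(1 - x) * k.im) * 1) := by
          gcongr
          rw [Real.exp_le_one_iff]
          exact mul_nonpos_of_nonneg_of_nonpos (by linarith) hρ
      _ = _ := by rw [mul_one]

/-! ### The regularised representation and its limit. -/

theorem initial_term (hu : IsClassicalSolution u₀ j u) (x : ℝ) {t : ℝ} (ht : 0 < t) :
    (∀ s, 0 ≤ s → Integrable fun k : ℝ => elem x (t + s) k * spaceTransform u₀ (-I * k)) ∧
    Tendsto (fun s : ℝ => ∫ k : ℝ, elem x (t + s) k * spaceTransform u₀ (-I * k)) (𝓝[>] 0)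
      (𝓝 (∫ k : ℝ, elem x t k * spaceTransform u₀ (-I * k))) := by
  obtain ⟨M, hM⟩ := hu.exists_bound_initial
  have hcont : ∀ s : ℝ, Continuous fun k : ℝ =>
      elem x (t + s) k * spaceTransform u₀ (-I * k) := fun s =>
    ((differentiable_elem x (t + s)).continuous.comp Complex.continuous_ofReal).mul
      ((differentiable_spaceTransform hu.continuousOn_initial).continuous.comp (by fun_prop))
  have hb : ∀ s, 0 ≤ s → ∀ k : ℝ, ‖elem x (t + s) k * spaceTransform u₀ (-I * k)‖
      ≤ M * Real.exp (-t * k ^ 2) := by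
    intro s hs k
    have hM0 : 0 ≤ M := (abs_nonneg _).trans (hM 0 (by simp))
    rw [norm_mul, norm_elem, mul_comm M]
    gcongr
    · rw [sq_re]
      simp
      nlinarith [mul_nonneg hs (sq_nonneg k)]
    · exact norm_spaceTransform_le_of_nonpos hM (by simp)
  refine ⟨fun s hs => integrable_of_gaussian_bound ht (hcont s) (hb s hs), ?_⟩
  refine tendsto_integral_filter_of_dominated_convergence (fun k => M * Real.exp (-t * k ^ 2))
    (Eventually.of_forall fun s => (hcont s).aestronglyMeasurable) ?_
    ((integrable_exp_neg_mul_sq ht).const_mul M) ?_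
  · filter_upwards [self_mem_nhdsWithin] with s hs
    exact Eventually.of_forall (hb s (le_of_lt hs))
  · refine Eventually.of_forall fun k => tendsto_nhdsWithin_of_tendsto_nhds ?_
    have : Continuous fun s : ℝ => elem x (t + s) k * spaceTransform u₀ (-I * k) := by
      unfold elem; fun_prop
    simpa using this.tendsto 0

/-- The Fourier representation of the regularised solution in terms of the boundary fluxes. -/
theorem integral_slice_eq (hu : IsClassicalSolution u₀ j u) {x t s : ℝ} (ht : 0 < t) (hs : 0 < s)
    (hL : Integrable fun k : ℝ => elem x (t + s) k * leftFlux u₀ j u t k)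
    (hR : Integrable fun k : ℝ => elem (1 - x) (t + s) k * rightFlux j u t k) :
    ∫ k : ℝ, elem x s k * spaceTransform (fun y => u y t) (-I * k)
      = (∫ k : ℝ, elem x (t + s) k * spaceTransform u₀ (-I * k))
        - (∫ k : ℝ, elem x (t + s) k * leftFlux u₀ j u t k)
        + ∫ k : ℝ, elem (1 - x) (t + s) k * rightFlux j u t k := by
  have hI := (hu.initial_term x ht).1 s hs.le
  have hR' := hR.comp_neg
  -- Reflecting the right-hand flux integral restores `elem x (t + s) k * e^{-ik}`; the integrands
  -- then agree pointwise, by the definition of the two fluxes.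
  rw [← integral_neg_eq_self (fun k : ℝ => elem (1 - x) (t + s) k * rightFlux j u t k),
    ← integral_sub hI hL]
  refine Eq.trans ?_ (integral_add (hI.sub hL) hR')
  refine integral_congr_ae (Eventually.of_forall fun k => ?_)
  simp only
  have e1 : elem x s k = elem x (t + s) k * Complex.exp ((k : ℂ) ^ 2 * t) := by
    rw [elem, elem, ← Complex.exp_add]
    congr 1
    push_cast
    ring
  have e2 : elem (1 - x) (t + s) (-k : ℂ) = elem x (t + s) k * Complex.exp (-I * k) := by
    have := elem_neg (1 - x) (t + s) (k : ℂ)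
    rwa [sub_sub_cancel] at this
  rw [Complex.ofReal_neg, e1, e2, leftFlux, rightFlux, neg_sq, h]
  ring

end IsClassicalSolution

end RobinHeat

theorem mainTheorem1 (u₀ j : ℝ → ℝ) (u : ℝ → ℝ → ℝ)
    (hu : RobinHeat.IsClassicalSolution u₀ j u)
    (x t ε : ℝ) (hx : x ∈ Set.Ioo (0 : ℝ) 1) (ht : 0 < t)
    (hj : IntervalIntegrable j MeasureTheory.volume 0 t)
    (hε : 0 < ε) (hεxt : 2 * ε * t < min x (1 - x)) :
    -- the denominator does not vanish on the contours
    (∀ k : ℂ, k.im ≠ 0 → RobinHeat.Δ k ≠ 0) ∧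
    -- the three integrals converge absolutely
    MeasureTheory.Integrable (fun k : ℝ =>
      RobinHeat.elem x t k * RobinHeat.spaceTransform u₀ (-Complex.I * k)) ∧
    RobinHeat.IntegrableBoundaryPlus ε (fun k =>
      RobinHeat.elem x t k / RobinHeat.Δ k * RobinHeat.μ₀ u₀ j t k) ∧
    RobinHeat.IntegrableBoundaryMinus ε (fun k =>
      RobinHeat.elem x t k / RobinHeat.Δ k * RobinHeat.μ₁ u₀ j t k) ∧
    -- the representation of the solution
    (u x t : ℂ) = 1 / (2 * Real.pi) *
      ((∫ k : ℝ, RobinHeat.elem x t k * RobinHeat.spaceTransform u₀ (-Complex.I * k))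
        - RobinHeat.integralBoundaryPlus ε (fun k =>
            RobinHeat.elem x t k / RobinHeat.Δ k * RobinHeat.μ₀ u₀ j t k)
        - RobinHeat.integralBoundaryMinus ε (fun k =>
            RobinHeat.elem x t k / RobinHeat.Δ k * RobinHeat.μ₁ u₀ j t k)) ∧
    -- the data on a future time slice do not contribute
    (∀ T : ℝ, t ≤ T →
      RobinHeat.IntegrableBoundaryPlus ε (fun k =>
        RobinHeat.elem x t k / RobinHeat.Δ k * RobinHeat.ν₀Future u T k) ∧
      RobinHeat.integralBoundaryPlus ε (fun k =>
        RobinHeat.elem x t k / RobinHeat.Δ k * RobinHeat.ν₀Future u T k) = 0 ∧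
      RobinHeat.IntegrableBoundaryMinus ε (fun k =>
        RobinHeat.elem x t k / RobinHeat.Δ k * (RobinHeat.h k * RobinHeat.ν₁Future u T k)) ∧
      RobinHeat.integralBoundaryMinus ε (fun k =>
        RobinHeat.elem x t k / RobinHeat.Δ k * (RobinHeat.h k * RobinHeat.ν₁Future u T k)) = 0) := by
  open RobinHeat in
  obtain ⟨CL, hCL0, hCL, hCL'⟩ := hu.exists_norm_leftFlux_le ht hj hε
  obtain ⟨CR, hCR0, hCR, hCR'⟩ := hu.exists_norm_rightFlux_le ht hj hε
  obtain ⟨hLi, hLb, hLlim⟩ := tendsto_integral_elem_mul hε ht.le hCL0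
    (hεxt.trans_le (min_le_left _ _)) (hu.differentiable_leftFlux ht.le hj) hCL hCL'
  obtain ⟨hRi, hRb, hRlim⟩ := tendsto_integral_elem_mul hε ht.le hCR0
    (hεxt.trans_le (min_le_right _ _)) (hu.differentiable_rightFlux ht.le hj) hCR hCR'
  obtain ⟨hI, hIlim⟩ := hu.initial_term x ht
  -- The slice `T = t` is the one occurring in `Δ_mul_leftFlux` and `Δ_mul_rightFlux'`. Subtracting
  -- its vanishing contribution turns the flux integrals into those of `μ₀` and `μ₁`.
  have hplus := hu.future_plus hx.1 ht.le le_rfl hε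
  have hminus := hu.future_minus hx.2 ht.le le_rfl hε
  rw [integrableBoundaryMinus_iff, integralBoundaryMinus_eq, neg_eq_zero] at hminus
  obtain ⟨hμ₀, hμ₀eq⟩ := integralBoundaryPlus_of_eq_sub
    (f := fun k => elem x t k / Δ k * μ₀ u₀ j t k) hε hLb hplus.1 fun k hk => by
      have hΔ := Δ_ne_zero hk.ne'
      have := hu.Δ_mul_leftFlux k ht hj
      field_simp
      linear_combination -(elem x t k) * this
  obtain ⟨hμ₁, hμ₁eq⟩ := integralBoundaryPlus_of_eq_sub
    (f := fun k => elem x t (-k) / Δ (-k) * μ₁ u₀ j t (-k)) hε hRb hminus.1 fun k hk => by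
      have hΔ := Δ_ne_zero hk.ne'
      have hR : rightFlux j u t k
          = -(Complex.exp (-I * k) * (μ₁ u₀ j t (-k) + h (-k) * ν₁Future u t (-k))) / Δ k := by
        rw [eq_div_iff hΔ, mul_comm, hu.Δ_mul_rightFlux' k ht hj]
      rw [hR, elem_neg, Δ_neg]
      ring
  rw [hplus.2, sub_zero] at hμ₀eq
  rw [hminus.2, sub_zero] at hμ₁eq
  refine ⟨fun k hk => Δ_ne_zero hk, by simpa using hI 0 le_rfl, hμ₀,
    (integrableBoundaryMinus_iff _ _).2 hμ₁, ?_, fun T hT => ?_⟩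
  · rw [integralBoundaryMinus_eq, hμ₀eq, hμ₁eq, sub_neg_eq_add]
    have hF := tendsto_integral_elem_mul_spaceTransform (hu.continuousOn_slice ht.le) hx
    have hlim := (hIlim.sub hLlim).add hRlim
    -- The two sides of `integral_slice_eq` have separate limits as `s → 0`; uniqueness of limits
    -- gives the representation.
    have heq := tendsto_nhds_unique hF (hlim.congr' (by
      filter_upwards [self_mem_nhdsWithin] with s hs
      exact (hu.integral_slice_eq ht hs (hLi s hs) (hRi s hs)).symm))
    rw [← heq]
    have hpi : (Real.pi : ℂ) ≠ 0 := by exact_mod_cast Real.pi_ne_zero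
    field_simp
  · have h1 := hu.future_plus hx.1 ht.le hT hε
    have h2 := hu.future_minus hx.2 ht.le hT hε
    exact ⟨h1.1, h1.2, h2.1, h2.2⟩
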